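/- **Setting.** Consider $L\ge 1$ links with complex channel matrices $\mathbf H_{l,k}$ from the transmitter of link $k$ to the receiver of link $l$, with $\mathbf H_{l,l}\ne 0$ for all $l$, and a coupling matrix $\mathbf\Phi\in\mathbb R_+^{L\times L}$ with zero diagonal (in particular any $0/1$ coupling matrix). For positive semidefinite input covariances $\mathbf\Sigma_{1:L}=(\mathbf\Sigma_1,\dots,\mathbf\Sigma_L)$ put $$\mathbf\Omega_l=\mathbf I+\sum_k\Phi_{l,k}\mathbf H_{l,k}\mathbf\Sigma_k\mathbf H_{l,k}^\dagger,\qquad \mathcal I_l(\mathbf\Sigma_{1:L})=\log\left|\mathbf I+\mathbf H_{l,l}\mathbf\Sigma_l\mathbf H_{l,l}^\dagger\mathbf\Omega_l^{-1}\right| .$$ Let $\mathcal I_l^0>0$ be target rates and $P_T>0$. * **FOPa**: maximize $\mathcal I_1/\mathcal I_1^0$ subject to $\mathcal I_l/\mathcal I_l^0\ge\mathcal I_1/\mathcal I_1^0$ for $l\ne1$, $\mathbf\Sigma_l\succeq0$ for all $l$, and $\sum_l\mathrm{Tr}(\mathbf\Sigma_l)\le P_T$. * **SPMP**: minimize $\sum_l\mathrm{Tr}(\mathbf\Sigma_l)$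 subject to $\mathcal I_l\ge\mathcal I_l^0$ and $\mathbf\Sigma_l\succeq0$ for all $l$. **Covariance transformation.** Decompose $\mathbf\Sigma_l=\sum_{m=1}^{M_l}p_{l,m}\mathbf t_{l,m}\mathbf t_{l,m}^\dagger$ with $p_{l,m}>0$, $\|\mathbf t_{l,m}\|=1$, and let $\mathbf r_{l,m}$ be the unit vectors proportional to $\big(\sum_{i>m}p_{l,i}\mathbf H_{l,l}\mathbf t_{l,i}\mathbf t_{l,i}^\dagger\mathbf H_{l,l}^\dagger+\mathbf\Omega_l\big)^{-1}\mathbf H_{l,l}\mathbf t_{l,m}$ (MMSE-SIC receivers). Let $\mathbf\Psi$ be the cross-talk matrix, whose entry in row $(l,m)$ and column $(k,n)$ is $0$ if $k=l$, $n\le m$; $|\mathbf r_{l,m}^\dagger\mathbf H_{l,l}\mathbf t_{l,n}|^2$ if $k=l$, $n>m$; and $\Phi_{l,k}|\mathbf r_{l,m}^\dagger\mathbf H_{l,k}\mathbf t_{k,n}|^2$ if $k\ne l$. Let $\gamma_{l,m}=p_{l,m}|\mathbf r_{l,m}^\dagger\mathbf H_{l,l}\mathbf t_{l,m}|^2/\big(1+(\mathbf\Psi\mathbf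 p)_{l,m}\big)$ be the achieved SINRs, $\mathbf D=\mathrm{diag}\big(\gamma_{l,m}/|\mathbf r_{l,m}^\dagger\mathbf H_{l,l}\mathbf t_{l,m}|^2\big)$ and $\mathbf q=(\mathbf D^{-1}-\mathbf\Psi^T)^{-1}\mathbf 1$. The resulting covariance transformation is $\hat{\mathbf\Sigma}_l=\sum_mq_{l,m}\mathbf r_{l,m}\mathbf r_{l,m}^\dagger$. Put $\hat{\mathbf\Omega}_l=\mathbf I+\sum_k\Phi_{k,l}\mathbf H_{k,l}^\dagger\hat{\mathbf\Sigma}_k\mathbf H_{k,l}$. **Polite water-filling.** $\mathbf\Sigma_{1:L}$ has the polite water-filling structure with levels $\nu_l\ge0$, with respect to its covariance transformation $\hat{\mathbf\Sigma}_{1:L}$, if for every $l$, with a thin SVD $\mathbf\Omega_l^{-1/2}\mathbf H_{l,l}\hat{\mathbf\Omega}_l^{-1/2}=\mathbf F_l\mathbf\Delta_l\mathbf G_l^\dagger$, one has $\hat{\mathbf\Omega}_l^{1/2}\mathbf\Sigma_l\hat{\mathbf\Omega}_l^{1/2}=\mathbf G_l(\nu_l\mathbf I-\mathbf\Delta_l^{-2})^+\mathbf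 G_l^\dagger$. **Optimality conditions.** (1) $\tilde{\mathbf\Sigma}_{1:L}$ has the polite water-filling structure with some levels $\tilde\nu_l$; (2) $\mathcal I_l(\tilde{\mathbf\Sigma}_{1:L})=\alpha\mathcal I_l^0$ for all $l$, with some $\alpha>0$ for FOPa and with $\alpha=1$ for SPMP; (3) for FOPa, $\sum_l\mathrm{Tr}(\tilde{\mathbf\Sigma}_l)=P_T$. **Theorem.** The following holds for FOPa and for SPMP. * *Necessity.* Every optimum $\tilde{\mathbf\Sigma}_{1:L}$ has a covariance transformation, and there are levels $\tilde\nu_l$ with which it satisfies the optimality conditions, with respect to each of its covariance transformations (that is, for every choice of the decomposition). * *KKT.* If $\tilde{\mathbf\Sigma}_{1:L}$ satisfies the optimality conditions (with respect to some covariance transformation), then it satisfies the KKT conditions of the problem (feasibility, nonnegative multipliers for the scalar constraints and positive semidefinite multipliers for $\mathbf\Sigma_l\succeq0$, complementary slackness, vanishing gradient of the Lagrangian with respect to the Hermitian matrices $\mathbf\Sigma_l$). Thus it is a stationary point: along any curve of feasible points that starts at $\tilde{\mathbf\Sigma}_{1:L}$ and is differentiable there, the derivative of the objective at the starting point, if it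 exists, is $\le0$ for FOPa and $\ge0$ for SPMP. * *Sufficiency.* If $\tilde{\mathbf\Sigma}_{1:L}$ satisfies the optimality conditions with levels $\tilde\nu_l$, and if $\sum_l\tilde\nu_l\mathcal I_l(\mathbf\Sigma_{1:L})$ is a concave function of $\mathbf\Sigma_{1:L}$ on the set of tuples of positive semidefinite matrices, then $\tilde{\mathbf\Sigma}_{1:L}$ is a global optimum of the problem. -/

import Mathlib

open scoped Matrix ComplexOrder MatrixOrder Topology

noncomputable section

/-- A MIMO B-MAC interference network with `L` data links. Link `l` has `nT l` transmit and
`nR l` receive antennas, `H l k` is the channel matrix from the transmitter of link `k` to the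
receiver of link `l`, and `Φ` is the coupling matrix: `Φ l k` is the weight with which the signal
of link `k` interferes with link `l` after interference cancellation (`1` if it is treated as
noise, `0` if it is cancelled). -/
structure BMAC (L : ℕ) where
  nT : Fin L → ℕ
  nR : Fin L → ℕ
  H : ∀ l k : Fin L, Matrix (Fin (nR l)) (Fin (nT k)) ℂ
  Φ : Matrix (Fin L) (Fin L) ℝ
  Φ_nonneg : ∀ l k, 0 ≤ Φ l k
  Φ_diag : ∀ l, Φ l l = 0

namespace BMAC

variable {L : ℕ}

/-- Tuples of matrices of the size of forward input covariances, one for each link. -/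
abbrev Cov (N : BMAC L) : Type :=
  ∀ l : Fin L, Matrix (Fin (N.nT l)) (Fin (N.nT l)) ℂ

/-- Tuples of matrices of the size of reverse-link input covariances, one for each link. -/
abbrev RevCov (N : BMAC L) : Type :=
  ∀ l : Fin L, Matrix (Fin (N.nR l)) (Fin (N.nR l)) ℂ

/-- Interference-plus-noise covariance `Ω_l = I + ∑_k Φ_{l,k} H_{l,k} Σ_k H_{l,k}†`. -/
def Omega (N : BMAC L) (S : N.Cov) (l : Fin L) : Matrix (Fin (N.nR l)) (Fin (N.nR l)) ℂ :=
  1 + ∑ k, N.Φ l k • (N.H l k * S k * (N.H l k)ᴴ)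

/-- Reverse-link interference-plus-noise covariance
`Ω̂_l = I + ∑_k Φ_{k,l} H_{k,l}† Σ̂_k H_{k,l}`. -/
def revOmega (N : BMAC L) (S' : N.RevCov) (l : Fin L) :
    Matrix (Fin (N.nT l)) (Fin (N.nT l)) ℂ :=
  1 + ∑ k, N.Φ k l • ((N.H k l)ᴴ * S' k * N.H k l)

/-- Rate of link `l`: `log |I + H_{l,l} Σ_l H_{l,l}† Ω_l⁻¹|`. -/
def rate (N : BMAC L) (S : N.Cov) (l : Fin L) : ℝ :=
  Real.log (1 + N.H l l * S l * (N.H l l)ᴴ * (N.Omega S l)⁻¹).det.re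

/-- The sum power `∑_l Tr Σ_l`. -/
def power (N : BMAC L) (S : N.Cov) : ℝ := ∑ l, (S l).trace.re

/-! ### Streams, MMSE-SIC receivers and the covariance transformation -/

/-- A transmission and reception strategy: link `l` carries `M l` streams, stream `m` of link `l`
has transmit power `p l m`, transmit vector `t l m` and receive vector `r l m`. -/
structure Strategy (N : BMAC L) where
  M : Fin L → ℕ
  p : ∀ l, Fin (M l) → ℝ
  t : ∀ l, Fin (M l) → (Fin (N.nT l) → ℂ)
  r : ∀ l, Fin (M l) → (Fin (N.nR l) → ℂ)

namespace Strategy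

variable {N : BMAC L}

/-- Index set of all streams of all links. -/
abbrev Stream (st : N.Strategy) : Type := Σ l : Fin L, Fin (st.M l)

/-- The transmit vectors and powers decompose `S` into data streams of positive power:
`Σ_l = ∑_m p_{l,m} t_{l,m} t_{l,m}†` with unit vectors `t_{l,m}`. -/
def IsDecomposition (st : N.Strategy) (S : N.Cov) : Prop :=
  (∀ l m, 0 < st.p l m) ∧
  (∀ l m, star (st.t l m) ⬝ᵥ st.t l m = 1) ∧
  ∀ l, S l = ∑ m, st.p l m • Matrix.vecMulVec (st.t l m) (star (st.t l m))

/-- Interference-plus-noise covariance seen by stream `m` of link `l`, when the streams of a link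
are decoded and cancelled in the order of their indices:
`∑_{i > m} p_{l,i} H_{l,l} t_{l,i} t_{l,i}† H_{l,l}† + Ω_l`. -/
def streamNoise (st : N.Strategy) (S : N.Cov) (l : Fin L) (m : Fin (st.M l)) :
    Matrix (Fin (N.nR l)) (Fin (N.nR l)) ℂ :=
  (∑ i ∈ Finset.Ioi m,
    st.p l i • (N.H l l * Matrix.vecMulVec (st.t l i) (star (st.t l i)) * (N.H l l)ᴴ)) +
    N.Omega S l

/-- The receive vectors are the normalized MMSE-SIC receive vectors. -/
def IsMMSE (st : N.Strategy) (S : N.Cov) : Prop :=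
  ∀ l m, star (st.r l m) ⬝ᵥ st.r l m = 1 ∧
    ∃ a : ℂ, st.r l m = a • ((st.streamNoise S l m)⁻¹ *ᵥ (N.H l l *ᵥ st.t l m))

/-- The gain `|r_{a}† H t_{b}|²` from stream `b` to the receive vector of stream `a`. -/
def gain (st : N.Strategy) (a b : st.Stream) : ℝ :=
  ‖star (st.r a.1 a.2) ⬝ᵥ (N.H a.1 b.1 *ᵥ st.t b.1 b.2)‖ ^ 2

/-- The cross-talk matrix `Ψ`: entry `(a, b)` is the interference from stream `b` to stream `a`
at unit transmit power. -/
def crossTalk (st : N.Strategy) : Matrix st.Stream st.Stream ℝ := fun a b =>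
  if a.1 = b.1 then (if (a.2 : ℕ) < (b.2 : ℕ) then st.gain a b else 0)
  else N.Φ a.1 b.1 * st.gain a b

/-- The SINR of a stream in the forward links. -/
def sinr (st : N.Strategy) (a : st.Stream) : ℝ :=
  st.p a.1 a.2 * st.gain a a / (1 + ∑ b : st.Stream, st.p b.1 b.2 * st.crossTalk a b)

/-- The diagonal matrix `D` with entries `γ_{l,m} / |r_{l,m}† H_{l,l} t_{l,m}|²`, where `γ` are
the SINRs achieved in the forward links. -/
def sinrDiag (st : N.Strategy) : Matrix st.Stream st.Stream ℝ :=
  Matrix.diagonal fun a => st.sinr a / st.gain a a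

/-- The reverse-link powers `q = (D⁻¹ - Ψᵀ)⁻¹ 1`. -/
def revPower (st : N.Strategy) : st.Stream → ℝ :=
  ((st.sinrDiag)⁻¹ - (st.crossTalk)ᵀ)⁻¹ *ᵥ 1

/-- The reverse-link input covariances `Σ̂_l = ∑_m q_{l,m} r_{l,m} r_{l,m}†`. -/
def revCov (st : N.Strategy) : N.RevCov := fun l =>
  ∑ m, st.revPower ⟨l, m⟩ • Matrix.vecMulVec (st.r l m) (star (st.r l m))

end Strategy

/-- `S'` is a covariance transformation of `S`, obtained from some decomposition of `S` into
data streams with MMSE-SIC receivers. -/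
def IsCovTransform (N : BMAC L) (S : N.Cov) (S' : N.RevCov) : Prop :=
  ∃ st : N.Strategy, st.IsDecomposition S ∧ st.IsMMSE S ∧ S' = st.revCov

/-! ### Polite water-filling -/

/-- `Q` has the structure of water-filling with level `ν` over the channel `Hb`: for a thin
singular value decomposition `Hb = F Δ G†` with positive singular values `δ`,
`Q = G (ν I - Δ⁻²)⁺ G†`. -/
def IsWaterFilling {m n : ℕ} (Hb : Matrix (Fin m) (Fin n) ℂ) (Q : Matrix (Fin n) (Fin n) ℂ)
    (ν : ℝ) : Prop :=
  ∃ (k : ℕ) (F : Matrix (Fin m) (Fin k) ℂ) (δ : Fin k → ℝ) (G : Matrix (Fin n) (Fin k) ℂ),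
    Fᴴ * F = 1 ∧ Gᴴ * G = 1 ∧ (∀ i, 0 < δ i) ∧
    Hb = F * Matrix.diagonal (fun i => (δ i : ℂ)) * Gᴴ ∧
    Q = G * Matrix.diagonal (fun i => ((max (ν - (δ i ^ 2)⁻¹) 0 : ℝ) : ℂ)) * Gᴴ

/-- `S` has the polite water-filling structure with levels `ν`, with respect to its covariance
transformation `S'`. -/
def HasPoliteWaterFilling (N : BMAC L) (S : N.Cov) (S' : N.RevCov) (ν : Fin L → ℝ) : Prop :=
  N.IsCovTransform S S' ∧ ∀ l, 0 ≤ ν l ∧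
    IsWaterFilling
      ((CFC.sqrt (N.Omega S l))⁻¹ * N.H l l * (CFC.sqrt (N.revOmega S' l))⁻¹)
      (CFC.sqrt (N.revOmega S' l) * S l * CFC.sqrt (N.revOmega S' l)) (ν l)

/-! ### The two optimization problems -/

/-- Feasible set of FOPa (the first link has index `0`). -/
def feasFOPa [NeZero L] (N : BMAC L) (I₀ : Fin L → ℝ) (P : ℝ) : Set N.Cov :=
  {S | (∀ l, l ≠ 0 → N.rate S 0 / I₀ 0 ≤ N.rate S l / I₀ l) ∧
    (∀ l, (S l).PosSemidef) ∧ N.power S ≤ P}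

/-- Objective of FOPa, to be maximized. -/
def objFOPa [NeZero L] (N : BMAC L) (I₀ : Fin L → ℝ) (S : N.Cov) : ℝ := N.rate S 0 / I₀ 0

/-- `S` is a (global) optimum of FOPa. -/
def IsOptFOPa [NeZero L] (N : BMAC L) (I₀ : Fin L → ℝ) (P : ℝ) (S : N.Cov) : Prop :=
  S ∈ N.feasFOPa I₀ P ∧ IsMaxOn (N.objFOPa I₀) (N.feasFOPa I₀ P) S

/-- Feasible set of SPMP, whose objective `power` is to be minimized. -/
def feasSPMP (N : BMAC L) (I₀ : Fin L → ℝ) : Set N.Cov :=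
  {S | (∀ l, I₀ l ≤ N.rate S l) ∧ ∀ l, (S l).PosSemidef}

/-- `S` is a (global) optimum of SPMP. -/
def IsOptSPMP (N : BMAC L) (I₀ : Fin L → ℝ) (S : N.Cov) : Prop :=
  S ∈ N.feasSPMP I₀ ∧ IsMinOn N.power (N.feasSPMP I₀) S

/-- The optimality conditions for FOPa. -/
def OptCondFOPa (N : BMAC L) (I₀ : Fin L → ℝ) (P : ℝ) (S : N.Cov) (S' : N.RevCov)
    (ν : Fin L → ℝ) : Prop :=
  N.HasPoliteWaterFilling S S' ν ∧ (∃ α : ℝ, 0 < α ∧ ∀ l, N.rate S l = α * I₀ l) ∧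
    N.power S = P

/-- The optimality conditions for SPMP. -/
def OptCondSPMP (N : BMAC L) (I₀ : Fin L → ℝ) (S : N.Cov) (S' : N.RevCov)
    (ν : Fin L → ℝ) : Prop :=
  N.HasPoliteWaterFilling S S' ν ∧ ∀ l, N.rate S l = I₀ l

/-! ### KKT conditions and stationarity -/

/-- Lagrangian of FOPa with multipliers `lam l` (`l ≠ 0`) for the rate-ratio constraints, `μ` for
the power constraint and `Θ l` for `Σ_l ⪰ 0`. -/
def lagrFOPa [NeZero L] (N : BMAC L) (I₀ : Fin L → ℝ) (P : ℝ) (lam : Fin L → ℝ) (μ : ℝ)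
    (Θ : N.Cov) (S : N.Cov) : ℝ :=
  N.rate S 0 / I₀ 0
    + ∑ l ∈ Finset.univ.erase 0, lam l * (N.rate S l / I₀ l - N.rate S 0 / I₀ 0)
    + μ * (P - N.power S) + ∑ l, (S l * Θ l).trace.re

/-- Lagrangian of SPMP. -/
def lagrSPMP (N : BMAC L) (I₀ : Fin L → ℝ) (lam : Fin L → ℝ) (Θ : N.Cov) (S : N.Cov) : ℝ :=
  N.power S - ∑ l, lam l * (N.rate S l - I₀ l) - ∑ l, (S l * Θ l).trace.re

/-- The gradients of `f` with respect to all the Hermitian matrices `Σ_l` vanish at `S`: `f` has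
zero derivative at `S` in every direction given by a tuple of Hermitian matrices. -/
def GradVanishes (N : BMAC L) (f : N.Cov → ℝ) (S : N.Cov) : Prop :=
  ∀ X : N.Cov, (∀ l, (X l).IsHermitian) → HasDerivAt (fun s : ℝ => f (S + s • X)) 0 0

/-- `S` satisfies the KKT conditions of FOPa. -/
def KKTFOPa [NeZero L] (N : BMAC L) (I₀ : Fin L → ℝ) (P : ℝ) (S : N.Cov) : Prop :=
  S ∈ N.feasFOPa I₀ P ∧
  ∃ (lam : Fin L → ℝ) (μ : ℝ) (Θ : N.Cov),
    (∀ l, l ≠ 0 → 0 ≤ lam l) ∧ 0 ≤ μ ∧ (∀ l, (Θ l).PosSemidef) ∧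
    (∀ l, l ≠ 0 → lam l * (N.rate S l / I₀ l - N.rate S 0 / I₀ 0) = 0) ∧
    μ * (P - N.power S) = 0 ∧
    (∀ l, (S l * Θ l).trace = 0) ∧
    N.GradVanishes (N.lagrFOPa I₀ P lam μ Θ) S

/-- `S` satisfies the KKT conditions of SPMP. -/
def KKTSPMP (N : BMAC L) (I₀ : Fin L → ℝ) (S : N.Cov) : Prop :=
  S ∈ N.feasSPMP I₀ ∧
  ∃ (lam : Fin L → ℝ) (Θ : N.Cov),
    (∀ l, 0 ≤ lam l) ∧ (∀ l, (Θ l).PosSemidef) ∧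
    (∀ l, lam l * (N.rate S l - I₀ l) = 0) ∧
    (∀ l, (S l * Θ l).trace = 0) ∧
    N.GradVanishes (N.lagrSPMP I₀ lam Θ) S

/-- `S` is a stationary point for maximizing `f` over `A`: to first order, `f` does not increase
along any curve that starts at `S`, stays in `A` and is differentiable at its starting point. -/
def IsStationaryMax (N : BMAC L) (f : N.Cov → ℝ) (A : Set N.Cov) (S : N.Cov) : Prop :=
  S ∈ A ∧ ∀ (c : ℝ → N.Cov) (v : N.Cov) (d : ℝ), c 0 = S → (∀ᶠ s in 𝓝[≥] (0 : ℝ), c s ∈ A) →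
    HasDerivWithinAt c v (Set.Ici 0) 0 →
    HasDerivWithinAt (fun s => f (c s)) d (Set.Ici 0) 0 → d ≤ 0

/-- The weighted sum rate is a concave function of the tuple of (positive semidefinite) input
covariance matrices. -/
def WeightedSumRateConcave (N : BMAC L) (ν : Fin L → ℝ) : Prop :=
  ConcaveOn ℝ {S : N.Cov | ∀ l, (S l).PosSemidef} (fun S => ∑ l, ν l * N.rate S l)

end BMAC

end

/-!
The optimality conditions say that all constraints are active and that the point is stationary
with positive rate multipliers. Both implications rest on an explicit form of the covariance
transformation.

Let `Y_l = Ω_l + H_{l,l} Σ_l H_{l,l}†` and call `ν_l (Ω_l⁻¹ - Y_l⁻¹)` the dual covariances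
(`BMAC.dualCov`). Differentiating `log |Y_l| - log |Ω_l|` shows (`BMAC.sum_rateDeriv`) that the
gradient of `∑ ν_l I_l - ∑ Tr Σ_l` with respect to `Σ_l` is `ν_l H†Y_l⁻¹H - Ω̂_l`, where `Ω̂_l` is
formed with the dual covariances. The KKT conditions therefore say that
`ν_l H†Y_l⁻¹H + Θ_l = Ω̂_l` with `Θ_l ⪰ 0` and `Θ_l Σ_l = 0` (`BMAC.IsPriced`). For given `Ω_l`
and `Ω̂_l` this is equivalent to the water-filling structure
(`BMAC.isWaterFilling_whitened_iff`): after whitening, `Σ_l` commutes with the Gram matrix of the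
channel, and its eigenvalues can be read off.

Polite water-filling uses the covariance transformation in place of the dual covariances, but the
two agree. By the Sherman–Morrison formula each MMSE-SIC stream contributes a multiple `c r r†` to
`Ω_l⁻¹ - Y_l⁻¹` (`BMAC.Strategy.weight_smul`), and if the stationarity condition holds on the
transmit vector of a stream, then the reverse-link SINR equation of the stream is satisfied exactly
by `q = ν_l c` (`BMAC.Strategy.revEquation_iff`). The system `(D⁻¹ - Ψᵀ) q = 1` has a unique
solution, which is nonnegative, because the forward powers `p > 0` solve `(D⁻¹ - Ψ) p = 1`. So the
covariance transformation is the dual one, both if stationarity holds with the dual covariances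
and, by induction along the decoding order, if it holds with the covariance transformation itself.

Stationarity along curves and, for a concave weighted sum rate, global optimality follow from the
Lagrangian. Necessity needs multipliers at an optimum. A separation argument
(`exists_nonneg_multipliers`) gives a nontrivial combination of objective and constraints, and the
power multiplier cannot vanish, because the derivative of each nonzero rate in the direction `Σ`
is `Tr (Ω_l⁻¹ - Y_l⁻¹) > 0`. A zero rate multiplier would force `Σ_l = 0`, so all constraints are
active. For FOPa the coefficient of the first rate could have either sign a priori; it is
nonnegative since switching off the first link helps all others, and the optimal value is positive
since a feasible point with positive rates exists.
-/

/-! ### Positive semidefinite matrices -/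

namespace Matrix

section PosSemidef

variable {m n : Type*} [Fintype m] [Fintype n] [DecidableEq m] [DecidableEq n]

theorem PosSemidef.trace_mul_nonneg {A B : Matrix n n ℂ} (hA : A.PosSemidef)
    (hB : B.PosSemidef) : 0 ≤ (A * B).trace := by
  obtain ⟨C, rfl⟩ := CStarAlgebra.nonneg_iff_eq_star_mul_self.mp hB.nonneg
  rw [star_eq_conjTranspose, ← Matrix.mul_assoc, Matrix.trace_mul_comm, ← Matrix.mul_assoc]
  exact (hA.mul_mul_conjTranspose_same C).trace_nonneg

theorem PosSemidef.mul_eq_zero_of_trace {A B : Matrix n n ℂ} (hA : A.PosSemidef)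
    (hB : B.PosSemidef) (h : (A * B).trace = 0) : A * B = 0 := by
  obtain ⟨C, rfl⟩ := CStarAlgebra.nonneg_iff_eq_star_mul_self.mp hB.nonneg
  obtain ⟨D, rfl⟩ := CStarAlgebra.nonneg_iff_eq_star_mul_self.mp hA.nonneg
  simp only [star_eq_conjTranspose] at *
  have h2 : (D * Cᴴ)ᴴ * (D * Cᴴ) = 0 := by
    refine (posSemidef_conjTranspose_mul_self (D * Cᴴ)).trace_eq_zero_iff.1 ?_
    rw [← h, conjTranspose_mul, conjTranspose_conjTranspose]
    rw [Matrix.mul_assoc, Matrix.trace_mul_comm]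
    simp only [Matrix.mul_assoc]
  rw [conjTranspose_mul_self_eq_zero] at h2
  rw [Matrix.mul_assoc, ← Matrix.mul_assoc D, h2, Matrix.zero_mul, Matrix.mul_zero]

theorem PosDef.exists_sq {A : Matrix n n ℂ} (hA : A.PosDef) :
    (CFC.sqrt A).PosDef ∧ CFC.sqrt A * CFC.sqrt A = A := by
  have h := CFC.sqrt_mul_sqrt_self A hA.posSemidef.nonneg
  refine ⟨?_, h⟩
  refine (nonneg_iff_posSemidef.1 (CFC.sqrt_nonneg A)).posDef_iff_isUnit.2 ?_
  exact isUnit_of_mul_isUnit_left (h ▸ hA.isUnit)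

theorem PosDef.mul_inv' {A : Matrix n n ℂ} (hA : A.PosDef) : A * A⁻¹ = 1 :=
  mul_nonsing_inv A ((isUnit_iff_isUnit_det A).1 hA.isUnit)

theorem PosDef.inv_mul' {A : Matrix n n ℂ} (hA : A.PosDef) : A⁻¹ * A = 1 :=
  nonsing_inv_mul A ((isUnit_iff_isUnit_det A).1 hA.isUnit)

theorem inv_sub_inv_add {A K : Matrix n n ℂ} (hA : A.PosDef) (hK : K.PosSemidef) :
    A⁻¹ - (A + K)⁻¹ = (A + K)⁻¹ * (K + K * A⁻¹ * K) * (A + K)⁻¹ := by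
  have hY : (A + K).PosDef := hA.add_posSemidef hK
  have h1 : K + K * A⁻¹ * K = (A + K) * A⁻¹ * (A + K) - (A + K) := by
    have e1 : A * A⁻¹ * (A + K) = A + K := by rw [hA.mul_inv', Matrix.one_mul]
    have e2 : K * A⁻¹ * (A + K) = K + K * A⁻¹ * K := by
      rw [Matrix.mul_add, Matrix.mul_assoc K A⁻¹ A, hA.inv_mul', Matrix.mul_one]
    rw [Matrix.add_mul A K A⁻¹, Matrix.add_mul, e1, e2]; abel
  rw [h1, Matrix.mul_sub, Matrix.sub_mul, hY.inv_mul', Matrix.one_mul, ← Matrix.mul_assoc,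
    ← Matrix.mul_assoc, hY.inv_mul', Matrix.one_mul, Matrix.mul_assoc, hY.mul_inv', Matrix.mul_one]

theorem posSemidef_inv_sub_inv_add {A K : Matrix n n ℂ} (hA : A.PosDef) (hK : K.PosSemidef) :
    (A⁻¹ - (A + K)⁻¹).PosSemidef := by
  have hY : (A + K).PosDef := hA.add_posSemidef hK
  rw [inv_sub_inv_add hA hK]
  have h1 : (K + K * A⁻¹ * K).PosSemidef := by
    refine hK.add ?_
    have := hA.inv.posSemidef.conjTranspose_mul_mul_same K
    rwa [hK.isHermitian.eq] at this
  have := h1.conjTranspose_mul_mul_same (A + K)⁻¹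
  rwa [hY.inv.isHermitian.eq] at this

theorem trace_inv_sub_inv_add_pos {A K : Matrix n n ℂ} (hA : A.PosDef) (hK : K.PosSemidef)
    (h : K ≠ 0) : 0 < (A⁻¹ - (A + K)⁻¹).trace := by
  refine lt_of_le_of_ne (posSemidef_inv_sub_inv_add hA hK).trace_nonneg fun h0 => h ?_
  have h1 := (posSemidef_inv_sub_inv_add hA hK).trace_eq_zero_iff.1 h0.symm
  have hY : (A + K).PosDef := hA.add_posSemidef hK
  rw [sub_eq_zero] at h1
  have h2 : A = A + K := by
    have := congrArg (fun X => A * X * (A + K)) h1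
    simpa [hA.mul_inv', Matrix.mul_assoc, hY.inv_mul'] using this.symm
  simpa using h2.symm

end PosSemidef

section ShermanMorrison

variable {n : Type*} [Fintype n] [DecidableEq n]

/-- The Sherman–Morrison formula for a positive rank-one update of a positive definite matrix. -/
theorem PosDef.inv_sub_inv_add_vecMulVec {A : Matrix n n ℂ} (hA : A.PosDef) (h : n → ℂ)
    {p s : ℝ} (hp : 0 ≤ p) (hs : star h ⬝ᵥ (A⁻¹ *ᵥ h) = (s : ℂ)) :
    A⁻¹ - (A + p • vecMulVec h (star h))⁻¹ =
      (p / (1 + p * s)) • vecMulVec (A⁻¹ *ᵥ h) (star (A⁻¹ *ᵥ h)) := by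
  have hs0 : 0 ≤ s := by
    have := hA.inv.posSemidef.dotProduct_mulVec_nonneg h
    rw [hs] at this; exact_mod_cast this
  have hne : (1 + p * s) ≠ 0 := by positivity
  have hst : star (A⁻¹ *ᵥ h) = star h ᵥ* A⁻¹ := by
    rw [star_mulVec, hA.inv.isHermitian.eq]
  rw [sub_eq_iff_eq_add, ← sub_eq_iff_eq_add', eq_comm]
  apply Matrix.inv_eq_right_inv
  rw [Matrix.mul_sub, Matrix.add_mul, Matrix.add_mul, hA.mul_inv', hst]
  have e1 : A * (p / (1 + p * s)) • vecMulVec (A⁻¹ *ᵥ h) (star h ᵥ* A⁻¹) =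
      (p / (1 + p * s)) • vecMulVec h (star h ᵥ* A⁻¹) := by
    rw [Matrix.mul_smul, mul_vecMulVec, mulVec_mulVec, hA.mul_inv', one_mulVec]
  have e2 : (p • vecMulVec h (star h)) * A⁻¹ = p • vecMulVec h (star h ᵥ* A⁻¹) := by
    rw [Matrix.smul_mul, vecMulVec_mul]
  have e3 : (p • vecMulVec h (star h)) * (p / (1 + p * s)) • vecMulVec (A⁻¹ *ᵥ h) (star h ᵥ* A⁻¹) =
      (p * (p / (1 + p * s)) * s) • vecMulVec h (star h ᵥ* A⁻¹) := by
    rw [Matrix.smul_mul, Matrix.mul_smul, vecMulVec_mul_vecMulVec, hs]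
    ext i j
    simp [vecMulVec_apply]
    ring
  rw [e1, e2, e3, ← add_smul, add_sub_assoc, ← sub_smul]
  have : p - (p / (1 + p * s) + p * (p / (1 + p * s)) * s) = 0 := by field_simp; ring
  rw [this, zero_smul, add_zero]

end ShermanMorrison

end Matrix

/-! ### Water-filling over a single channel -/

namespace BMAC

open Matrix

variable {m n : ℕ}

/-- The stationarity condition for `ν log |I + Hb Q Hb†| - Tr Q`, with multiplier `Θ` of `Q ⪰ 0`,
makes `Q` diagonal in each eigenbasis of `Hb† Hb`, with the water-filling eigenvalues. No
simultaneous diagonalization is needed: `Q` commutes with `Hb† Hb`, so that `Q v` and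
`Q v - (ν - a⁻¹) v` are again eigenvectors, and the signs of `Q` and `Θ` on them decide. -/
theorem mulVec_eigenvector_of_multiplier {Hb : Matrix (Fin m) (Fin n) ℂ}
    {Q Θ : Matrix (Fin n) (Fin n) ℂ} {ν : ℝ}
    (hQ : Q.PosSemidef) (hΘ : Θ.PosSemidef) (hΘQ : Θ * Q = 0)
    (h : ν • (Hbᴴ * (1 + Hb * Q * Hbᴴ)⁻¹ * Hb) + Θ = 1)
    {v : Fin n → ℂ} {a : ℝ} (hv : (Hbᴴ * Hb) *ᵥ v = (a : ℂ) • v) (ha : 0 ≤ a) :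
    Q *ᵥ v = ((if a = 0 then 0 else max (ν - a⁻¹) 0 : ℝ) : ℂ) • v := by
  set A := Hbᴴ * Hb with hA
  have hAh : Aᴴ = A := by rw [hA, conjTranspose_mul, conjTranspose_conjTranspose]
  have hQh : Qᴴ = Q := hQ.isHermitian.eq
  have hΘh : Θᴴ = Θ := hΘ.isHermitian.eq
  have hQΘ : Q * Θ = 0 := by
    have := congrArg conjTranspose hΘQ
    simpa [conjTranspose_mul, hQh, hΘh] using this
  have hY : (1 + Hb * Q * Hbᴴ).PosDef :=
    PosDef.one.add_posSemidef (hQ.mul_mul_conjTranspose_same Hb)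
  -- pushing `Hb†` through the inverse turns the condition into a polynomial identity
  have key : ν • A + Θ = 1 + A * Q := by
    have e1 : (1 + A * Q) * Hbᴴ = Hbᴴ * (1 + Hb * Q * Hbᴴ) := by
      simp only [hA, Matrix.add_mul, Matrix.mul_add, Matrix.mul_assoc, Matrix.one_mul,
        Matrix.mul_one]
    have e2 := congrArg (fun X => (1 + A * Q) * X) h
    have e3 : (1 + A * Q) * (Hbᴴ * (1 + Hb * Q * Hbᴴ)⁻¹ * Hb) = A := by
      rw [← Matrix.mul_assoc, ← Matrix.mul_assoc, e1, Matrix.mul_assoc Hbᴴ, hY.mul_inv',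
        Matrix.mul_one]
    simp only [Matrix.mul_add, Matrix.mul_smul, e3, Matrix.mul_one] at e2
    rw [← e2, Matrix.add_mul, Matrix.one_mul, Matrix.mul_assoc A Q Θ, hQΘ, Matrix.mul_zero,
      add_zero]
  have comm : Q * A = A * Q := by
    have := congrArg conjTranspose key
    simp only [conjTranspose_add, conjTranspose_smul, hAh, hΘh, conjTranspose_one,
      conjTranspose_mul, hQh, star_trivial] at this
    rw [key] at this
    exact (add_left_cancel this).symm
  have hΘvec : ∀ w : Fin n → ℂ, A *ᵥ w = (a : ℂ) • w →
      Θ *ᵥ w = w + (a : ℂ) • (Q *ᵥ w) - ((ν * a : ℝ) : ℂ) • w := by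
    intro w hw
    have h1 : Θ = 1 + A * Q - ν • A := by rw [← key]; abel
    rw [h1, Matrix.sub_mulVec, Matrix.add_mulVec, one_mulVec, ← comm, ← mulVec_mulVec, hw,
      mulVec_smul, Matrix.smul_mulVec, hw]
    ext i; simp; ring
  have hAQ : A *ᵥ (Q *ᵥ v) = (a : ℂ) • (Q *ᵥ v) := by
    rw [mulVec_mulVec, ← comm, ← mulVec_mulVec, hv, mulVec_smul]
  have hw0 : Q *ᵥ v + (a : ℂ) • (Q *ᵥ (Q *ᵥ v)) - ((ν * a : ℝ) : ℂ) • (Q *ᵥ v) = 0 := by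
    rw [← hΘvec _ hAQ, mulVec_mulVec, hΘQ, zero_mulVec]
  by_cases ha0 : a = 0
  · subst ha0; simpa using hw0
  have hapos : 0 < a := lt_of_le_of_ne ha (Ne.symm ha0)
  simp only [ha0, if_false]
  set c := ν - a⁻¹ with hc
  have hac : ν * a = 1 + a * c := by rw [hc]; field_simp; ring
  have haC : (a : ℂ) ≠ 0 := by exact_mod_cast ha0
  have hQw : Q *ᵥ (Q *ᵥ v) = (c : ℂ) • (Q *ᵥ v) := by
    have : (a : ℂ) • (Q *ᵥ (Q *ᵥ v) - (c : ℂ) • (Q *ᵥ v)) = 0 := by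
      rw [← hw0, hac]; ext i; simp; ring
    exact sub_eq_zero.1 ((smul_eq_zero.1 this).resolve_left haC)
  rcases lt_or_ge 0 c with hcp | hcn
  · rw [max_eq_left hcp.le]
    set x := Q *ᵥ v - (c : ℂ) • v with hx
    have hAx : A *ᵥ x = (a : ℂ) • x := by
      rw [hx, mulVec_sub, hAQ, mulVec_smul, hv]; ext i; simp; ring
    have hQx : Q *ᵥ x = 0 := by rw [hx, mulVec_sub, hQw, mulVec_smul, sub_self]
    have hΘx : Θ *ᵥ x = ((-(a * c) : ℝ) : ℂ) • x := by
      rw [hΘvec x hAx, hQx, hac]; ext i; simp; ring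
    have h1 := hΘ.dotProduct_mulVec_nonneg x
    rw [hΘx, dotProduct_smul, smul_eq_mul] at h1
    have h2 : (0 : ℂ) ≤ star x ⬝ᵥ x := dotProduct_star_self_nonneg x
    have h3 : star x ⬝ᵥ x = 0 := by
      obtain ⟨r, hr⟩ : ∃ r : ℝ, star x ⬝ᵥ x = (r : ℂ) :=
        ⟨_, (Complex.eq_re_of_ofReal_le h2)⟩
      rw [hr] at h1 h2 ⊢
      norm_cast at h1 h2 ⊢
      nlinarith [mul_pos hapos hcp]
    rw [dotProduct_star_self_eq_zero] at h3
    rw [← sub_eq_zero, ← hx, h3]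
  · rw [max_eq_right hcn]
    simp only [Complex.ofReal_zero, zero_smul]
    have h1 := hQ.dotProduct_mulVec_nonneg (Q *ᵥ v)
    rw [hQw, dotProduct_smul, smul_eq_mul] at h1
    have h2 : (0 : ℂ) ≤ star (Q *ᵥ v) ⬝ᵥ (Q *ᵥ v) := dotProduct_star_self_nonneg _
    rw [← dotProduct_star_self_eq_zero (R := ℂ)]
    rcases hcn.lt_or_eq with hc0 | hc0
    · obtain ⟨r, hr⟩ : ∃ r : ℝ, star (Q *ᵥ v) ⬝ᵥ (Q *ᵥ v) = (r : ℂ) :=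
        ⟨_, (Complex.eq_re_of_ofReal_le h2)⟩
      rw [hr] at h1 h2 ⊢
      norm_cast at h1 h2 ⊢
      nlinarith
    · rw [star_mulVec, hQh, ← dotProduct_mulVec, hQw, hc0]
      simp

end BMAC

namespace Matrix

theorem IsHermitian.exists_unitary_eigenvectors {n : ℕ} {A : Matrix (Fin n) (Fin n) ℂ}
    (hA : A.IsHermitian) : ∃ (U : Matrix (Fin n) (Fin n) ℂ) (a : Fin n → ℝ), U * Uᴴ = 1 ∧
      Uᴴ * U = 1 ∧ ∀ i, A *ᵥ (fun r => U r i) = (a i : ℂ) • (fun r => U r i) := by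
  refine ⟨hA.eigenvectorUnitary, hA.eigenvalues, ?_, ?_, fun i => ?_⟩
  · exact Unitary.mul_star_self_of_mem hA.eigenvectorUnitary.2
  · exact Unitary.star_mul_self_of_mem hA.eigenvectorUnitary.2
  · have := hA.mulVec_eigenvectorBasis i
    ext r
    have h2 := congrFun this r
    simpa [IsHermitian.eigenvectorUnitary_apply, mulVec, dotProduct] using h2

theorem sum_vecMulVec_eq_of_unitary {m n : ℕ} {U : Matrix (Fin n) (Fin n) ℂ} (hU : U * Uᴴ = 1)
    (B : Matrix (Fin m) (Fin n) ℂ) :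
    ∑ i, vecMulVec (B *ᵥ (fun r => U r i)) (star (fun r => U r i)) = B := by
  conv_rhs => rw [← Matrix.mul_one B, ← hU, ← Matrix.mul_assoc]
  ext r s
  simp [Matrix.sum_apply, vecMulVec_apply, mul_apply, mulVec, dotProduct]

end Matrix

/-- Enumeration of the indices outside the zero set of `a`, as the index set of a thin
decomposition. -/
theorem exists_fin_enum_ne_zero {n : ℕ} (a : Fin n → ℝ) :
    ∃ (k : ℕ) (e : Fin k → Fin n), Function.Injective e ∧ (∀ j, a (e j) ≠ 0) ∧
      ∀ {M : Type} [AddCommMonoid M] (f : Fin n → M), (∀ i, a i = 0 → f i = 0) →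
        ∑ j, f (e j) = ∑ i, f i := by
  classical
  let E := Fintype.equivFin {i // a i ≠ 0}
  refine ⟨_, fun j => (E.symm j : Fin n), ?_, fun j => (E.symm j).2, fun f hf => ?_⟩
  · exact Subtype.val_injective.comp E.symm.injective
  · rw [Equiv.sum_comp E.symm (fun i : {i // a i ≠ 0} => f i)]
    rw [← Finset.sum_filter_of_ne (p := fun i => a i ≠ 0) fun i _ hi h0 => hi (hf i h0)]
    exact (Finset.sum_subtype _ (by simp) f).symm

namespace BMAC

open Matrix

variable {m n : ℕ}

/-- Stationarity implies the water-filling structure. The thin singular value decomposition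
consists of the eigenvectors of `Hb† Hb` with nonzero eigenvalue. -/
theorem isWaterFilling_of_multiplier {Hb : Matrix (Fin m) (Fin n) ℂ}
    {Q Θ : Matrix (Fin n) (Fin n) ℂ} {ν : ℝ}
    (hQ : Q.PosSemidef) (hΘ : Θ.PosSemidef) (hΘQ : Θ * Q = 0)
    (h : ν • (Hbᴴ * (1 + Hb * Q * Hbᴴ)⁻¹ * Hb) + Θ = 1) : IsWaterFilling Hb Q ν := by
  have hA := posSemidef_conjTranspose_mul_self Hb
  obtain ⟨U, a, hUU, hUU', hev⟩ := hA.isHermitian.exists_unitary_eigenvectors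
  have hnorm : ∀ i j, star (fun r => U r i) ⬝ᵥ (fun r => U r j) = (1 : Matrix _ _ ℂ) i j := by
    intro i j; rw [← hUU']; simp [mul_apply, dotProduct]
  have hHH : ∀ i j, star (Hb *ᵥ fun r => U r i) ⬝ᵥ (Hb *ᵥ fun r => U r j) =
      (a j : ℂ) * (1 : Matrix _ _ ℂ) i j := by
    intro i j
    rw [star_mulVec, ← dotProduct_mulVec, mulVec_mulVec, hev, dotProduct_smul, hnorm, smul_eq_mul]
  have ha : ∀ i, 0 ≤ a i := by
    intro i
    have h1 : (0 : ℂ) ≤ star (Hb *ᵥ fun r => U r i) ⬝ᵥ (Hb *ᵥ fun r => U r i) :=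
      dotProduct_star_self_nonneg _
    rw [hHH] at h1
    simpa using h1
  have hH0 : ∀ i, a i = 0 → Hb *ᵥ (fun r => U r i) = 0 := by
    intro i hi
    rw [← dotProduct_star_self_eq_zero (R := ℂ), hHH, hi]; simp
  have hQev := fun i => mulVec_eigenvector_of_multiplier hQ hΘ hΘQ h (hev i) (ha i)
  obtain ⟨k, e, he, hae, hsum⟩ := exists_fin_enum_ne_zero a
  have hpos : ∀ j, 0 < a (e j) := fun j => lt_of_le_of_ne (ha _) (hae j).symm
  have hsq : ∀ j, (Real.sqrt (a (e j))) ^ 2 = a (e j) := fun j => Real.sq_sqrt (ha _)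
  have hsne : ∀ j, (Real.sqrt (a (e j)) : ℂ) ≠ 0 := fun j => by
    exact_mod_cast (Real.sqrt_pos.2 (hpos j)).ne'
  refine ⟨k, Matrix.of fun r j => (Hb *ᵥ fun r => U r (e j)) r / (Real.sqrt (a (e j)) : ℂ),
    fun j => Real.sqrt (a (e j)), Matrix.of fun r j => U r (e j), ?_, ?_,
    fun j => Real.sqrt_pos.2 (hpos j), ?_, ?_⟩
  · ext i j
    have h1 := hHH (e i) (e j)
    have h2 : (1 : Matrix (Fin n) (Fin n) ℂ) (e i) (e j) = (1 : Matrix (Fin k) (Fin k) ℂ) i j := by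
      simp [Matrix.one_apply, he.eq_iff]
    rw [h2] at h1
    have h3 : (a (e j) : ℂ) = (Real.sqrt (a (e j)) : ℂ) ^ 2 := by
      rw [← Complex.ofReal_pow, hsq]
    have h4 : ((Matrix.of fun r j => (Hb *ᵥ fun r => U r (e j)) r / (Real.sqrt (a (e j)) : ℂ))ᴴ *
        (Matrix.of fun r j => (Hb *ᵥ fun r => U r (e j)) r / (Real.sqrt (a (e j)) : ℂ))) i j =
        (star (Hb *ᵥ fun r => U r (e i)) ⬝ᵥ (Hb *ᵥ fun r => U r (e j))) /
          ((Real.sqrt (a (e i)) : ℂ) * (Real.sqrt (a (e j)) : ℂ)) := by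
      simp only [mul_apply, conjTranspose_apply, Matrix.of_apply, dotProduct, Finset.sum_div]
      refine Finset.sum_congr rfl fun r _ => ?_
      simp only [Pi.star_apply, RCLike.star_def, map_div₀, Complex.conj_ofReal]
      field_simp [hsne i, hsne j]
    rw [h4, h1, h3]
    by_cases hij : i = j
    · subst hij
      simp only [one_apply_eq]
      field_simp [hsne i]
    · simp [hij]
  · ext i j
    have := hnorm (e i) (e j)
    simpa [mul_apply, dotProduct, Matrix.one_apply, he.eq_iff] using this
  · conv_lhs => rw [← sum_vecMulVec_eq_of_unitary hUU Hb]
    rw [← hsum _ (fun i hi => by rw [hH0 i hi, zero_vecMulVec])]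
    ext r s
    rw [Matrix.mul_apply]
    simp only [Matrix.sum_apply, vecMulVec_apply, mul_diagonal, Matrix.of_apply,
      conjTranspose_apply, Pi.star_apply]
    refine Finset.sum_congr rfl fun j _ => ?_
    rw [div_mul_cancel₀ _ (hsne j)]
  · conv_lhs => rw [← sum_vecMulVec_eq_of_unitary hUU Q]
    rw [← hsum _ (fun i hi => by rw [hQev i, if_pos hi]; simp)]
    ext r s
    rw [Matrix.mul_apply]
    simp only [Matrix.sum_apply, mul_diagonal, Matrix.of_apply, conjTranspose_apply]
    refine Finset.sum_congr rfl fun j _ => ?_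
    rw [hQev (e j), if_neg (hae j), hsq]
    simp only [vecMulVec_apply, Pi.smul_apply, smul_eq_mul, Pi.star_apply]
    ring

/-- The water-filling structure implies stationarity, with the multiplier
`Θ = I - ν Hb†(I + Hb Q Hb†)⁻¹ Hb`, which is diagonal in the singular vectors. -/
theorem IsWaterFilling.multiplier {Hb : Matrix (Fin m) (Fin n) ℂ}
    {Q : Matrix (Fin n) (Fin n) ℂ} {ν : ℝ} (h : IsWaterFilling Hb Q ν) :
    ∃ Θ : Matrix (Fin n) (Fin n) ℂ, Θ.PosSemidef ∧ Θ * Q = 0 ∧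
      ν • (Hbᴴ * (1 + Hb * Q * Hbᴴ)⁻¹ * Hb) + Θ = 1 := by
  obtain ⟨k, F, δ, G, hF, hG, hδ, rfl, rfl⟩ := h
  set d : Fin k → ℝ := fun i => max (ν - (δ i ^ 2)⁻¹) 0 with hd
  have hd0 : ∀ i, 0 ≤ d i := fun i => le_max_right _ _
  have hp : ∀ i, 0 < 1 + δ i ^ 2 * d i := fun i => by have := hd0 i; positivity
  set Δ : Matrix (Fin k) (Fin k) ℂ := diagonal fun i => (δ i : ℂ) with hΔ
  set E : Matrix (Fin k) (Fin k) ℂ := diagonal fun i => (d i : ℂ) with hE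
  have hΔh : Δᴴ = Δ := by
    rw [hΔ, diagonal_conjTranspose]; congr 1; ext i; simp
  have hEpsd : E.PosSemidef := PosSemidef.diagonal fun i => by
    simpa using hd0 i
  set Hb := F * Δ * Gᴴ with hHb
  have hHbh : Hbᴴ = G * Δ * Fᴴ := by
    simp [hHb, conjTranspose_mul, hΔh, Matrix.mul_assoc]
  have hQ : (G * E * Gᴴ).PosSemidef := hEpsd.mul_mul_conjTranspose_same G
  have hY : (1 + Hb * (G * E * Gᴴ) * Hbᴴ).PosDef :=
    PosDef.one.add_posSemidef (hQ.mul_mul_conjTranspose_same Hb)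
  set T : Matrix (Fin k) (Fin k) ℂ := diagonal fun i => ((1 + δ i ^ 2 * d i : ℝ) : ℂ) with hT
  set T' : Matrix (Fin k) (Fin k) ℂ := diagonal fun i => ((1 + δ i ^ 2 * d i : ℝ) : ℂ)⁻¹ with hT'
  have hTT : T * T' = 1 := by
    rw [hT, hT', diagonal_mul_diagonal, ← diagonal_one]
    congr 1; ext i
    exact mul_inv_cancel₀ (by exact_mod_cast (hp i).ne')
  have hYF : (1 + Hb * (G * E * Gᴴ) * Hbᴴ) * F = F * T := by
    have e1 : Hb * (G * E * Gᴴ) * Hbᴴ * F = F * (Δ * E * Δ) := by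
      rw [hHbh, hHb]
      calc F * Δ * Gᴴ * (G * E * Gᴴ) * (G * Δ * Fᴴ) * F
          = F * (Δ * ((Gᴴ * G) * E * (Gᴴ * G)) * Δ) * (Fᴴ * F) := by
            simp only [Matrix.mul_assoc]
        _ = _ := by rw [hG, hF]; simp [Matrix.mul_assoc]
    rw [Matrix.add_mul, e1, Matrix.one_mul]
    have e2 : T = 1 + Δ * E * Δ := by
      rw [hT, hΔ, hE, diagonal_mul_diagonal, diagonal_mul_diagonal, ← diagonal_one, diagonal_add]
      congr 1; ext i; push_cast; ring
    rw [e2, Matrix.mul_add, Matrix.mul_one]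
  have hYF' : (1 + Hb * (G * E * Gᴴ) * Hbᴴ)⁻¹ * F = F * T' := by
    have hYi := hY.inv_mul'
    generalize 1 + Hb * (G * E * Gᴴ) * Hbᴴ = Y at hYF hYi
    calc Y⁻¹ * F = Y⁻¹ * (F * T) * T' := by
          rw [Matrix.mul_assoc, Matrix.mul_assoc, hTT, Matrix.mul_one]
      _ = F * T' := by rw [← hYF, ← Matrix.mul_assoc, hYi, Matrix.one_mul]
  set f : Fin k → ℝ := fun i => ν * (δ i ^ 2 / (1 + δ i ^ 2 * d i)) with hf
  set D : Matrix (Fin k) (Fin k) ℂ := diagonal fun i => (f i : ℂ) with hD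
  have hmain : ν • (Hbᴴ * (1 + Hb * (G * E * Gᴴ) * Hbᴴ)⁻¹ * Hb) = G * D * Gᴴ := by
    have e1 : Hbᴴ * (1 + Hb * (G * E * Gᴴ) * Hbᴴ)⁻¹ * Hb = G * (Δ * T' * Δ) * Gᴴ := by
      generalize (1 + Hb * (G * E * Gᴴ) * Hbᴴ)⁻¹ = Yi at hYF'
      rw [hHbh, hHb]
      calc G * Δ * Fᴴ * Yi * (F * Δ * Gᴴ) = G * Δ * Fᴴ * (Yi * F) * Δ * Gᴴ := by
            simp only [Matrix.mul_assoc]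
        _ = G * (Δ * (Fᴴ * F) * T' * Δ) * Gᴴ := by rw [hYF']; simp only [Matrix.mul_assoc]
        _ = _ := by rw [hF, Matrix.mul_one]
    rw [e1, ← Matrix.smul_mul, ← Matrix.mul_smul]
    congr 2
    rw [hΔ, hT', hD, diagonal_mul_diagonal, diagonal_mul_diagonal, ← diagonal_smul]
    congr 1; ext i
    simp only [Pi.smul_apply, hf, Complex.real_smul]
    push_cast
    ring
  have hf1 : ∀ i, f i ≤ 1 ∧ (1 - f i) * d i = 0 := by
    intro i
    have hδ2 : 0 < δ i ^ 2 := pow_pos (hδ i) 2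
    rcases le_total (ν - (δ i ^ 2)⁻¹) 0 with h0 | h0
    · have hdi : d i = 0 := max_eq_right h0
      refine ⟨?_, by rw [hdi, mul_zero]⟩
      simp only [hf, hdi, mul_zero, add_zero, div_one]
      have := mul_le_mul_of_nonneg_right (sub_nonpos.1 h0) hδ2.le
      rwa [inv_mul_cancel₀ hδ2.ne'] at this
    · have hdi : d i = ν - (δ i ^ 2)⁻¹ := max_eq_left h0
      have hν : 0 < ν := lt_of_lt_of_le (inv_pos.2 hδ2) (sub_nonneg.1 h0)
      have : f i = 1 := by
        simp only [hf, hdi]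
        have e : 1 + δ i ^ 2 * (ν - (δ i ^ 2)⁻¹) = ν * δ i ^ 2 := by
          rw [mul_sub, mul_inv_cancel₀ hδ2.ne']; ring
        rw [e, mul_div_assoc', div_self (mul_pos hν hδ2).ne']
      rw [this]; simp
  refine ⟨1 - G * D * Gᴴ, ?_, ?_, by rw [hmain]; abel⟩
  · have e1 : (1 : Matrix (Fin n) (Fin n) ℂ) - G * D * Gᴴ =
        (1 - G * Gᴴ)ᴴ * (1 - G * Gᴴ) + G * (diagonal fun i => ((1 - f i : ℝ) : ℂ)) * Gᴴ := by
      have e2 : (diagonal fun i => ((1 - f i : ℝ) : ℂ)) = (1 : Matrix (Fin k) (Fin k) ℂ) - D := by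
        rw [hD, ← diagonal_one, diagonal_sub]; congr 1; ext i; push_cast; rfl
      have e3 : G * Gᴴ * (G * Gᴴ) = G * Gᴴ := by
        calc G * Gᴴ * (G * Gᴴ) = G * (Gᴴ * G) * Gᴴ := by simp only [Matrix.mul_assoc]
          _ = _ := by rw [hG, Matrix.mul_one]
      have e4 : (1 - G * Gᴴ)ᴴ = 1 - G * Gᴴ := by simp [conjTranspose_mul]
      rw [e2, e4, Matrix.mul_sub, Matrix.sub_mul, Matrix.sub_mul, e3, Matrix.mul_sub,
        Matrix.sub_mul]
      simp
    rw [e1]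
    refine (posSemidef_conjTranspose_mul_self _).add (PosSemidef.mul_mul_conjTranspose_same ?_ G)
    exact PosSemidef.diagonal fun i => by
      have := (hf1 i).1
      simp only [Pi.zero_apply]
      exact_mod_cast sub_nonneg.2 this
  · have e1 : G * D * Gᴴ * (G * E * Gᴴ) = G * (D * E) * Gᴴ := by
      calc G * D * Gᴴ * (G * E * Gᴴ) = G * (D * (Gᴴ * G) * E) * Gᴴ := by
            simp only [Matrix.mul_assoc]
        _ = _ := by rw [hG, Matrix.mul_one]
    have e2 : D * E = E := by
      rw [hD, hE, diagonal_mul_diagonal]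
      congr 1; ext i
      have := (hf1 i).2
      have : f i * d i = d i := by linarith
      exact_mod_cast this
    rw [Matrix.sub_mul, e1, e2, Matrix.one_mul, sub_self]

end BMAC

namespace BMAC

open Matrix

variable {m n : ℕ}

/-- Water-filling over the channel whitened by `Ω^(-1/2)` and `R^(-1/2)` is equivalent to the
stationarity condition `ν H†(Ω + H S H†)⁻¹H + Θ = R` with a multiplier `Θ ⪰ 0` of `S ⪰ 0`. -/
theorem isWaterFilling_whitened_iff {Ω : Matrix (Fin m) (Fin m) ℂ}
    {R S : Matrix (Fin n) (Fin n) ℂ} {H : Matrix (Fin m) (Fin n) ℂ} {ν : ℝ}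
    (hΩ : Ω.PosDef) (hR : R.PosDef) (hS : S.PosSemidef) :
    IsWaterFilling ((CFC.sqrt Ω)⁻¹ * H * (CFC.sqrt R)⁻¹) (CFC.sqrt R * S * CFC.sqrt R) ν ↔
      ∃ Θ : Matrix (Fin n) (Fin n) ℂ, Θ.PosSemidef ∧ Θ * S = 0 ∧
        ν • (Hᴴ * (Ω + H * S * Hᴴ)⁻¹ * H) + Θ = R := by
  obtain ⟨hW, hWW⟩ := hΩ.exists_sq
  obtain ⟨hV, hVV⟩ := hR.exists_sq
  generalize CFC.sqrt Ω = W at *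
  generalize CFC.sqrt R = V at *
  have hWh : (W⁻¹)ᴴ = W⁻¹ := hW.inv.isHermitian.eq
  have hVh : (V⁻¹)ᴴ = V⁻¹ := hV.inv.isHermitian.eq
  have hVh' : Vᴴ = V := hV.isHermitian.eq
  have hVi := hV.mul_inv'
  have hVi' := hV.inv_mul'
  have hWi := hW.mul_inv'
  have hWi' := hW.inv_mul'
  have hY : (Ω + H * S * Hᴴ).PosDef := hΩ.add_posSemidef (hS.mul_mul_conjTranspose_same H)
  have hYi := hY.mul_inv'
  set Hb := W⁻¹ * H * V⁻¹ with hHb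
  have hHbh : Hbᴴ = V⁻¹ * Hᴴ * W⁻¹ := by
    simp only [hHb, conjTranspose_mul, hWh, hVh, Matrix.mul_assoc]
  have hQ : (V * S * V).PosSemidef := by
    have := hS.mul_mul_conjTranspose_same V
    rwa [hVh'] at this
  have e1 : 1 + Hb * (V * S * V) * Hbᴴ = W⁻¹ * (Ω + H * S * Hᴴ) * W⁻¹ := by
    have a1 : W⁻¹ * Ω * W⁻¹ = 1 := by
      rw [← hWW, ← Matrix.mul_assoc, hWi', Matrix.one_mul, hWi]
    have a2 : Hb * (V * S * V) * Hbᴴ = W⁻¹ * (H * S * Hᴴ) * W⁻¹ := by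
      rw [hHbh, hHb]
      calc W⁻¹ * H * V⁻¹ * (V * S * V) * (V⁻¹ * Hᴴ * W⁻¹)
          = W⁻¹ * H * (V⁻¹ * V) * S * (V * V⁻¹) * Hᴴ * W⁻¹ := by simp only [Matrix.mul_assoc]
        _ = _ := by rw [hVi, hVi']; simp only [Matrix.mul_assoc, Matrix.one_mul]
    rw [a2, Matrix.mul_add, Matrix.add_mul, a1]
  have e2 : (1 + Hb * (V * S * V) * Hbᴴ)⁻¹ = W * (Ω + H * S * Hᴴ)⁻¹ * W := by
    rw [e1]
    apply Matrix.inv_eq_right_inv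
    generalize (Ω + H * S * Hᴴ) = Y at *
    calc W⁻¹ * Y * W⁻¹ * (W * Y⁻¹ * W) = W⁻¹ * Y * (W⁻¹ * W) * Y⁻¹ * W := by
          simp only [Matrix.mul_assoc]
      _ = W⁻¹ * (Y * Y⁻¹) * W := by rw [hWi']; simp only [Matrix.mul_assoc, Matrix.one_mul]
      _ = 1 := by rw [hYi, Matrix.mul_one, hWi']
  have e3 : Hbᴴ * (1 + Hb * (V * S * V) * Hbᴴ)⁻¹ * Hb =
      V⁻¹ * (Hᴴ * (Ω + H * S * Hᴴ)⁻¹ * H) * V⁻¹ := by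
    rw [e2, hHbh, hHb]
    generalize (Ω + H * S * Hᴴ)⁻¹ = Y at *
    calc V⁻¹ * Hᴴ * W⁻¹ * (W * Y * W) * (W⁻¹ * H * V⁻¹)
        = V⁻¹ * Hᴴ * (W⁻¹ * W) * Y * (W * W⁻¹) * H * V⁻¹ := by simp only [Matrix.mul_assoc]
      _ = _ := by rw [hWi, hWi']; simp only [Matrix.mul_assoc, Matrix.one_mul]
  constructor
  · intro h
    obtain ⟨Θ, hΘ, hΘQ, h1⟩ := h.multiplier
    rw [e3] at h1
    refine ⟨V * Θ * V, ?_, ?_, ?_⟩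
    · have := hΘ.mul_mul_conjTranspose_same V
      rwa [hVh'] at this
    · have := congrArg (fun X => V * X * V⁻¹) hΘQ
      simp only [Matrix.mul_assoc, hVi, Matrix.mul_one, Matrix.mul_zero, Matrix.zero_mul] at this
      simpa only [Matrix.mul_assoc] using this
    · have := congrArg (fun X => V * X * V) h1
      rw [← hVV]
      simp only [Matrix.mul_one] at this
      rw [← this, Matrix.mul_add, Matrix.add_mul, Matrix.mul_smul, Matrix.smul_mul]
      congr 2
      generalize Hᴴ * (Ω + H * S * Hᴴ)⁻¹ * H = X
      calc X = (V * V⁻¹) * X * (V⁻¹ * V) := by rw [hVi, hVi', Matrix.mul_one, Matrix.one_mul]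
        _ = _ := by simp only [Matrix.mul_assoc]
  · rintro ⟨Θ, hΘ, hΘS, h1⟩
    refine isWaterFilling_of_multiplier (Θ := V⁻¹ * Θ * V⁻¹) hQ ?_ ?_ ?_
    · have := hΘ.mul_mul_conjTranspose_same V⁻¹
      rwa [hVh] at this
    · calc V⁻¹ * Θ * V⁻¹ * (V * S * V) = V⁻¹ * (Θ * ((V⁻¹ * V) * S)) * V := by
            simp only [Matrix.mul_assoc]
        _ = 0 := by rw [hVi', Matrix.one_mul, hΘS, Matrix.mul_zero, Matrix.zero_mul]
    · rw [e3, ← Matrix.smul_mul, ← Matrix.mul_smul, ← Matrix.add_mul, ← Matrix.mul_add, h1, ← hVV,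
        ← Matrix.mul_assoc, hVi', Matrix.one_mul, hVi]

end BMAC

/-! ### Diagonally dominated cross-talk matrices -/

namespace Matrix

variable {ι : Type*} [Fintype ι]

/-- Summing the inequalities `d x ≤ Ψᵀ x` with the weights `p` and using `(d - Ψ) p = 1` gives
`∑ x ≤ 0`. -/
theorem eq_zero_of_mul_le_sum {Ψ : Matrix ι ι ℝ} {d p x : ι → ℝ}
    (h : ∀ a, d a * p a = 1 + ∑ b, Ψ a b * p b) (hp : ∀ a, 0 < p a) (hx : ∀ a, 0 ≤ x a)
    (hle : ∀ a, d a * x a ≤ ∑ b, Ψ b a * x b) : x = 0 := by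
  have h1 : ∑ a, p a * (d a * x a) ≤ ∑ a, p a * ∑ b, Ψ b a * x b :=
    Finset.sum_le_sum fun a _ => mul_le_mul_of_nonneg_left (hle a) (hp a).le
  have h2 : ∑ a, p a * ∑ b, Ψ b a * x b = ∑ b, x b * ∑ a, Ψ b a * p a := by
    simp only [Finset.mul_sum]
    rw [Finset.sum_comm]
    exact Finset.sum_congr rfl fun b _ => Finset.sum_congr rfl fun a _ => by ring
  have h3 : ∑ a, p a * (d a * x a) = ∑ a, x a + ∑ b, x b * ∑ a, Ψ b a * p a := by
    rw [← Finset.sum_add_distrib]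
    refine Finset.sum_congr rfl fun a _ => ?_
    linear_combination x a * h a
  have h4 : ∑ a, x a = 0 :=
    le_antisymm (by linarith) (Finset.sum_nonneg fun a _ => hx a)
  funext a
  exact (Finset.sum_eq_zero_iff_of_nonneg fun a _ => hx a).1 h4 a (Finset.mem_univ a)

variable [DecidableEq ι]

theorem diagonal_sub_transpose_mulVec {Ψ : Matrix ι ι ℝ} {d x : ι → ℝ} (a : ι) :
    ((diagonal d - Ψᵀ) *ᵥ x) a = d a * x a - ∑ b, Ψ b a * x b := by
  rw [sub_mulVec, Pi.sub_apply, mulVec_diagonal]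
  simp [mulVec, dotProduct]

theorem isUnit_det_diagonal_sub_transpose {Ψ : Matrix ι ι ℝ} {d p : ι → ℝ}
    (hΨ : ∀ a b, 0 ≤ Ψ a b) (h : ∀ a, d a * p a = 1 + ∑ b, Ψ a b * p b) (hp : ∀ a, 0 < p a) :
    IsUnit (diagonal d - Ψᵀ).det := by
  have hd : ∀ a, 0 < d a := fun a => by
    have : 0 ≤ ∑ b, Ψ a b * p b := Finset.sum_nonneg fun b _ => mul_nonneg (hΨ a b) (hp b).le
    exact pos_of_mul_pos_left (by rw [h]; linarith) (hp a).le
  rw [isUnit_iff_ne_zero]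
  intro h0
  obtain ⟨v, hv, hv0⟩ := exists_mulVec_eq_zero_iff.2 h0
  refine hv ?_
  have := eq_zero_of_mul_le_sum (x := fun a => |v a|) h hp (fun a => abs_nonneg _) fun a => by
    have h1 := congrFun hv0 a
    rw [diagonal_sub_transpose_mulVec, Pi.zero_apply, sub_eq_zero] at h1
    rw [← abs_of_pos (hd a), ← abs_mul, h1]
    refine (Finset.abs_sum_le_sum_abs _ _).trans_eq (Finset.sum_congr rfl fun b _ => ?_)
    rw [abs_mul, abs_of_nonneg (hΨ b a)]
  funext a
  exact abs_eq_zero.1 (congrFun this a)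

/-- The negative part of `q` satisfies the homogeneous inequalities. -/
theorem nonneg_of_diagonal_sub_transpose_mulVec {Ψ : Matrix ι ι ℝ} {d p q : ι → ℝ}
    (hΨ : ∀ a b, 0 ≤ Ψ a b) (h : ∀ a, d a * p a = 1 + ∑ b, Ψ a b * p b) (hp : ∀ a, 0 < p a)
    (hq : (diagonal d - Ψᵀ) *ᵥ q = 1) (a : ι) : 0 ≤ q a := by
  have := eq_zero_of_mul_le_sum (x := fun a => max (-q a) 0) h hp (fun a => le_max_right _ _)
    fun a => by
      have h1 := congrFun hq a
      rw [diagonal_sub_transpose_mulVec, Pi.one_apply] at h1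
      have h2 : -∑ b, Ψ b a * q b ≤ ∑ b, Ψ b a * max (-q b) 0 := by
        rw [← Finset.sum_neg_distrib]
        refine Finset.sum_le_sum fun b _ => ?_
        rw [← mul_neg]
        exact mul_le_mul_of_nonneg_left (le_max_left _ _) (hΨ b a)
      rcases le_total (-q a) 0 with h3 | h3
      · simp only [max_eq_right h3, mul_zero]
        exact Finset.sum_nonneg fun b _ => mul_nonneg (hΨ b a) (le_max_right _ _)
      · simp only [max_eq_left h3]
        linarith
  have := congrFun this a
  simpa using this

end Matrix

/-! ### Interference covariances and cross-talk of streams -/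

namespace BMAC

open Matrix

variable {L : ℕ} {N : BMAC L}

theorem dotProduct_vecMulVec_mulVec {n : ℕ} (v w : Fin n → ℂ) :
    star v ⬝ᵥ (vecMulVec w (star w) *ᵥ v) = ((‖star w ⬝ᵥ v‖ ^ 2 : ℝ) : ℂ) := by
  rw [vecMulVec_mulVec, dotProduct_smul]
  have : star v ⬝ᵥ w = star (star w ⬝ᵥ v) := by rw [star_dotProduct]
  rw [this]
  simp only [MulOpposite.smul_eq_mul_unop, MulOpposite.unop_op, RCLike.star_def]
  rw [Complex.conj_mul']; push_cast; rfl

theorem mul_vecMulVec_star_mul {m n : ℕ} (H : Matrix (Fin m) (Fin n) ℂ) (t : Fin n → ℂ) :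
    H * vecMulVec t (star t) * Hᴴ = vecMulVec (H *ᵥ t) (star (H *ᵥ t)) := by
  rw [mul_vecMulVec, vecMulVec_mul, star_mulVec]

theorem Omega_posDef {S : N.Cov} (hS : ∀ l, (S l).PosSemidef) (l : Fin L) :
    (N.Omega S l).PosDef :=
  PosDef.one.add_posSemidef <| posSemidef_sum _ fun k _ =>
    ((hS k).mul_mul_conjTranspose_same _).smul (N.Φ_nonneg l k)

theorem revOmega_sub_one_posSemidef {S' : N.RevCov} (hS : ∀ l, (S' l).PosSemidef) (l : Fin L) :
    (N.revOmega S' l - 1).PosSemidef := by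
  rw [revOmega, add_sub_cancel_left]
  exact posSemidef_sum _ fun k _ =>
    ((hS k).conjTranspose_mul_mul_same _).smul (N.Φ_nonneg k l)

theorem revOmega_posDef {S' : N.RevCov} (hS : ∀ l, (S' l).PosSemidef) (l : Fin L) :
    (N.revOmega S' l).PosDef := by
  have := (PosDef.one (R := ℂ)).add_posSemidef (revOmega_sub_one_posSemidef hS l)
  rwa [add_sub_cancel] at this

/-- Covariance of the total received signal of a link: signal, interference and noise. -/
noncomputable def totalCov (N : BMAC L) (S : N.Cov) (l : Fin L) :
    Matrix (Fin (N.nR l)) (Fin (N.nR l)) ℂ :=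
  N.Omega S l + N.H l l * S l * (N.H l l)ᴴ

theorem totalCov_posDef {S : N.Cov} (hS : ∀ l, (S l).PosSemidef) (l : Fin L) :
    (N.totalCov S l).PosDef :=
  (Omega_posDef hS l).add_posSemidef ((hS l).mul_mul_conjTranspose_same _)

namespace Strategy

variable {st : N.Strategy} {S : N.Cov}

theorem IsDecomposition.posSemidef (h : st.IsDecomposition S) (l : Fin L) :
    (S l).PosSemidef := by
  rw [h.2.2 l]
  exact posSemidef_sum _ fun m _ => (posSemidef_vecMulVec_self_star _).smul (h.1 l m).le

theorem gain_nonneg (a b : st.Stream) : 0 ≤ st.gain a b := sq_nonneg _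

theorem crossTalk_nonneg (a b : st.Stream) : 0 ≤ st.crossTalk a b := by
  have := N.Φ_nonneg a.1 b.1
  have := gain_nonneg a b
  unfold crossTalk
  split_ifs <;> positivity

/-- The distinction of the links can be dropped in the second summand because `Φ l l = 0`. -/
theorem crossTalk_eq (a b : st.Stream) : st.crossTalk a b =
    (if a.1 = b.1 then (if (a.2 : ℕ) < (b.2 : ℕ) then st.gain a b else 0) else 0) +
      N.Φ a.1 b.1 * st.gain a b := by
  unfold crossTalk
  by_cases h : a.1 = b.1
  · simp only [h, if_true]
    rw [N.Φ_diag, zero_mul, add_zero]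
  · simp [h]

theorem sum_crossTalk (x : st.Stream → ℝ) (l : Fin L) (m : Fin (st.M l)) :
    ∑ b, x b * st.crossTalk ⟨l, m⟩ b = (∑ n ∈ Finset.Ioi m, x ⟨l, n⟩ * st.gain ⟨l, m⟩ ⟨l, n⟩) +
      ∑ k, N.Φ l k * ∑ n, x ⟨k, n⟩ * st.gain ⟨l, m⟩ ⟨k, n⟩ := by
  rw [Fintype.sum_sigma]
  simp only [crossTalk_eq, mul_add, Finset.sum_add_distrib]
  congr 1
  · rw [Finset.sum_eq_single l (fun k _ hk => Finset.sum_eq_zero fun n _ => by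
      rw [if_neg (Ne.symm hk), mul_zero]) (by simp)]
    simp only [if_true, mul_ite, mul_zero]
    rw [← Finset.sum_filter]
    refine Finset.sum_congr ?_ fun _ _ => rfl
    ext n; simp
  · refine Finset.sum_congr rfl fun k _ => ?_
    rw [Finset.mul_sum]
    exact Finset.sum_congr rfl fun n _ => by ring

theorem sum_crossTalk_transpose (x : st.Stream → ℝ) (l : Fin L) (m : Fin (st.M l)) :
    ∑ b, st.crossTalk b ⟨l, m⟩ * x b = (∑ n ∈ Finset.Iio m, x ⟨l, n⟩ * st.gain ⟨l, n⟩ ⟨l, m⟩) +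
      ∑ k, N.Φ k l * ∑ n, x ⟨k, n⟩ * st.gain ⟨k, n⟩ ⟨l, m⟩ := by
  rw [Fintype.sum_sigma]
  simp only [crossTalk_eq, add_mul, Finset.sum_add_distrib]
  congr 1
  · rw [Finset.sum_eq_single l (fun k _ hk => Finset.sum_eq_zero fun n _ => by
      rw [if_neg hk, zero_mul]) (by simp)]
    simp only [if_true, ite_mul, zero_mul]
    rw [← Finset.sum_filter]
    refine Finset.sum_congr ?_ fun _ _ => mul_comm _ _
    ext n; simp
  · refine Finset.sum_congr rfl fun k _ => ?_
    rw [Finset.mul_sum]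
    exact Finset.sum_congr rfl fun n _ => by ring

theorem quad_Omega (h : st.IsDecomposition S) (l : Fin L) (v : Fin (N.nR l) → ℂ) :
    star v ⬝ᵥ (N.Omega S l *ᵥ v) = star v ⬝ᵥ v +
      ((∑ k, N.Φ l k * ∑ n, st.p k n * ‖star v ⬝ᵥ (N.H l k *ᵥ st.t k n)‖ ^ 2 : ℝ) : ℂ) := by
  rw [Omega, add_mulVec, one_mulVec, dotProduct_add, sum_mulVec, dotProduct_sum]
  congr 1
  push_cast
  refine Finset.sum_congr rfl fun k _ => ?_
  rw [smul_mulVec, dotProduct_smul, h.2.2 k, Matrix.mul_sum, Matrix.sum_mul, sum_mulVec,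
    dotProduct_sum, Complex.real_smul]
  congr 1
  refine Finset.sum_congr rfl fun n _ => ?_
  rw [Matrix.mul_smul, Matrix.smul_mul, mul_vecMulVec_star_mul, smul_mulVec, dotProduct_smul,
    dotProduct_vecMulVec_mulVec, Complex.real_smul]
  congr 1
  have : star (N.H l k *ᵥ st.t k n) ⬝ᵥ v = star (star v ⬝ᵥ (N.H l k *ᵥ st.t k n)) := by
    rw [star_dotProduct]
  rw [this, norm_star]; push_cast; rfl

/-- The reverse-link covariances obtained from given powers `q` of the receive vectors. -/
noncomputable def covOf (st : N.Strategy) (q : st.Stream → ℝ) : N.RevCov := fun l =>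
  ∑ m, q ⟨l, m⟩ • vecMulVec (st.r l m) (star (st.r l m))

theorem covOf_posSemidef {q : st.Stream → ℝ} (hq : ∀ a, 0 ≤ q a) (l : Fin L) :
    (st.covOf q l).PosSemidef :=
  posSemidef_sum _ fun m _ => (posSemidef_vecMulVec_self_star _).smul (hq ⟨l, m⟩)

theorem quad_revOmega (q : st.Stream → ℝ) (l : Fin L) (v : Fin (N.nT l) → ℂ) :
    star v ⬝ᵥ (N.revOmega (st.covOf q) l *ᵥ v) = star v ⬝ᵥ v +
      ((∑ k, N.Φ k l * ∑ n, q ⟨k, n⟩ * ‖star (st.r k n) ⬝ᵥ (N.H k l *ᵥ v)‖ ^ 2 : ℝ) : ℂ) := by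
  rw [revOmega, add_mulVec, one_mulVec, dotProduct_add, sum_mulVec, dotProduct_sum]
  congr 1
  push_cast
  refine Finset.sum_congr rfl fun k _ => ?_
  rw [smul_mulVec, dotProduct_smul, covOf, Matrix.mul_sum, Matrix.sum_mul, sum_mulVec,
    dotProduct_sum, Complex.real_smul]
  congr 1
  refine Finset.sum_congr rfl fun n _ => ?_
  rw [Matrix.mul_smul, Matrix.smul_mul, smul_mulVec, dotProduct_smul, Complex.real_smul]
  congr 1
  rw [← mulVec_mulVec, ← mulVec_mulVec, dotProduct_mulVec, ← star_mulVec,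
    dotProduct_vecMulVec_mulVec]
  push_cast; rfl

end Strategy

end BMAC

/-! ### MMSE-SIC receivers -/

namespace BMAC.Strategy

open Matrix

variable {L : ℕ} {N : BMAC L} {st : N.Strategy} {S : N.Cov}

/-- Covariance of noise, interference and the signals of the streams with index at least `j`. It
interpolates between the total received covariance (`j = 0`) and `Ω_l` (`j = M l`). -/
noncomputable def tail (st : N.Strategy) (S : N.Cov) (l : Fin L) (j : ℕ) :
    Matrix (Fin (N.nR l)) (Fin (N.nR l)) ℂ :=
  N.Omega S l + ∑ i ∈ Finset.univ.filter fun i : Fin (st.M l) => j ≤ (i : ℕ),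
    st.p l i • vecMulVec (N.H l l *ᵥ st.t l i) (star (N.H l l *ᵥ st.t l i))

theorem tail_posDef (h : st.IsDecomposition S) (l : Fin L) (j : ℕ) : (st.tail S l j).PosDef :=
  (Omega_posDef h.posSemidef l).add_posSemidef <| posSemidef_sum _ fun i _ =>
    (posSemidef_vecMulVec_self_star _).smul (h.1 l i).le

theorem tail_zero (h : st.IsDecomposition S) (l : Fin L) : st.tail S l 0 = N.totalCov S l := by
  rw [tail, totalCov, h.2.2 l, Matrix.mul_sum, Matrix.sum_mul]
  simp only [zero_le, Finset.filter_true, Matrix.mul_smul, Matrix.smul_mul,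
    mul_vecMulVec_star_mul]

theorem tail_last (l : Fin L) : st.tail S l (st.M l) = N.Omega S l := by
  rw [tail, Finset.filter_false_of_mem (fun i _ => by simp)]
  simp

theorem tail_succ (l : Fin L) (m : Fin (st.M l)) :
    st.tail S l (m + 1) = st.streamNoise S l m := by
  rw [tail, streamNoise, add_comm]
  simp only [mul_vecMulVec_star_mul]
  congr 1
  refine Finset.sum_congr ?_ fun _ _ => rfl
  ext i
  simp only [Finset.mem_filter, Finset.mem_univ, true_and, Finset.mem_Ioi, Fin.lt_def,
    Nat.succ_le_iff]

theorem tail_eq_add (l : Fin L) (m : Fin (st.M l)) :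
    st.tail S l m = st.streamNoise S l m +
      st.p l m • vecMulVec (N.H l l *ᵥ st.t l m) (star (N.H l l *ᵥ st.t l m)) := by
  rw [← tail_succ, tail, tail, add_assoc]
  congr 1
  have : (Finset.univ.filter fun i : Fin (st.M l) => (m : ℕ) ≤ i) =
      insert m (Finset.univ.filter fun i : Fin (st.M l) => (m : ℕ) + 1 ≤ i) := by
    ext i
    simp only [Finset.mem_filter, Finset.mem_univ, true_and, Finset.mem_insert, Fin.ext_iff]
    omega
  rw [this, Finset.sum_insert (by simp), add_comm]

theorem streamNoise_posDef (h : st.IsDecomposition S) (l : Fin L) (m : Fin (st.M l)) :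
    (st.streamNoise S l m).PosDef := tail_succ (S := S) l m ▸ tail_posDef h l _

theorem quad_streamNoise (h : st.IsDecomposition S) (hm : st.IsMMSE S) (l : Fin L)
    (m : Fin (st.M l)) :
    star (st.r l m) ⬝ᵥ (st.streamNoise S l m *ᵥ st.r l m) =
      ((1 + ∑ b : st.Stream, st.p b.1 b.2 * st.crossTalk ⟨l, m⟩ b : ℝ) : ℂ) := by
  rw [sum_crossTalk (fun b => st.p b.1 b.2), streamNoise, add_mulVec, dotProduct_add,
    quad_Omega h, (hm l m).1, sum_mulVec, dotProduct_sum]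
  have : ∀ i, star (st.r l m) ⬝ᵥ ((st.p l i • (N.H l l * vecMulVec (st.t l i) (star (st.t l i)) *
      (N.H l l)ᴴ)) *ᵥ st.r l m) = ((st.p l i * st.gain ⟨l, m⟩ ⟨l, i⟩ : ℝ) : ℂ) := by
    intro i
    rw [mul_vecMulVec_star_mul, smul_mulVec, dotProduct_smul, dotProduct_vecMulVec_mulVec,
      Complex.real_smul, ← Complex.ofReal_mul]
    have : star (N.H l l *ᵥ st.t l i) ⬝ᵥ st.r l m =
        star (star (st.r l m) ⬝ᵥ (N.H l l *ᵥ st.t l i)) := by rw [star_dotProduct]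
    rw [this, norm_star]; rfl
  simp only [this]
  push_cast
  simp only [gain]
  push_cast
  ring

/-- The gain and the SINR of a stream in terms of the scaling `α` of its MMSE receive vector and
of `s = h† W⁻¹ h`, where `h = H t` and `W` is the noise seen by the stream. -/
theorem exists_mmse_scaling (h : st.IsDecomposition S) (hm : st.IsMMSE S) (l : Fin L)
    (m : Fin (st.M l)) : ∃ (α : ℂ) (s : ℝ), 0 < ‖α‖ ∧ 0 < s ∧
      st.r l m = α • ((st.streamNoise S l m)⁻¹ *ᵥ (N.H l l *ᵥ st.t l m)) ∧
      star (N.H l l *ᵥ st.t l m) ⬝ᵥ ((st.streamNoise S l m)⁻¹ *ᵥ (N.H l l *ᵥ st.t l m)) = (s : ℂ) ∧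
      st.gain ⟨l, m⟩ ⟨l, m⟩ = ‖α‖ ^ 2 * s ^ 2 ∧
      1 + ∑ b : st.Stream, st.p b.1 b.2 * st.crossTalk ⟨l, m⟩ b = ‖α‖ ^ 2 * s := by
  obtain ⟨hr, α, hα⟩ := hm l m
  have hW := streamNoise_posDef h l m
  have hquad := quad_streamNoise h hm l m
  have hgain : st.gain ⟨l, m⟩ ⟨l, m⟩ = ‖star (st.r l m) ⬝ᵥ (N.H l l *ᵥ st.t l m)‖ ^ 2 := rfl
  generalize N.H l l *ᵥ st.t l m = x at *
  generalize st.streamNoise S l m = W at *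
  have hr0 : st.r l m ≠ 0 := by rintro h0; rw [h0] at hr; simp at hr
  have hα0 : α ≠ 0 := by rintro rfl; simp at hα; exact hr0 hα
  have hx0 : x ≠ 0 := by rintro rfl; simp at hα; exact hr0 hα
  have hspos := hW.inv.dotProduct_mulVec_pos hx0
  have hsre : star x ⬝ᵥ (W⁻¹ *ᵥ x) = ((star x ⬝ᵥ (W⁻¹ *ᵥ x)).re : ℂ) :=
    Complex.eq_re_of_ofReal_le hspos.le
  generalize (star x ⬝ᵥ (W⁻¹ *ᵥ x)).re = s at hsre
  rw [hsre] at hspos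
  have hs : 0 < s := by exact_mod_cast hspos
  have hrx : star (st.r l m) ⬝ᵥ x = star α * s := by
    rw [hα, star_smul, smul_dotProduct, star_mulVec, hW.inv.isHermitian.eq, ← dotProduct_mulVec,
      hsre, smul_eq_mul]
  refine ⟨α, s, norm_pos_iff.2 hα0, hs, hα, hsre, ?_, ?_⟩
  · rw [hgain, hrx, norm_mul, norm_star, Complex.norm_real, Real.norm_of_nonneg hs.le, mul_pow]
  · have h1 : W *ᵥ st.r l m = α • x := by
      rw [hα, mulVec_smul, mulVec_mulVec, hW.mul_inv', one_mulVec]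
    rw [h1, dotProduct_smul, hrx, smul_eq_mul, ← mul_assoc, RCLike.star_def,
      Complex.mul_conj'] at hquad
    exact_mod_cast hquad.symm

/-- The weight `γ² / (p g (1 + γ))` with which the projection `r r†` on the receive vector of a
stream enters `Ω⁻¹ - (Ω + H Σ H†)⁻¹`. -/
noncomputable def weight (st : N.Strategy) (a : st.Stream) : ℝ :=
  st.sinr a ^ 2 / (st.p a.1 a.2 * st.gain a a * (1 + st.sinr a))

/-- Cancelling one more stream is a rank-one update, in the direction of the MMSE receive vector,
of the inverse noise covariance. -/
theorem weight_smul (h : st.IsDecomposition S) (hm : st.IsMMSE S) (l : Fin L)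
    (m : Fin (st.M l)) :
    st.weight ⟨l, m⟩ • vecMulVec (st.r l m) (star (st.r l m)) =
      (st.tail S l (m + 1))⁻¹ - (st.tail S l m)⁻¹ := by
  obtain ⟨α, s, hα, hs, hr, hsx, hg, hc⟩ := exists_mmse_scaling h hm l m
  have hp := h.1 l m
  rw [tail_succ, tail_eq_add, (streamNoise_posDef h l m).inv_sub_inv_add_vecMulVec _ hp.le hsx]
  have hw : st.weight ⟨l, m⟩ * ‖α‖ ^ 2 = st.p l m / (1 + st.p l m * s) := by
    have : (1 + st.p l m * s) ≠ 0 := by positivity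
    simp only [weight, sinr, hg, hc]
    field_simp
  rw [← hw, hr]
  ext i j
  simp only [Matrix.smul_apply, vecMulVec_apply, Pi.smul_apply, Pi.star_apply, smul_eq_mul,
    star_mul', Complex.real_smul]
  have : α * star α = ((‖α‖ ^ 2 : ℝ) : ℂ) := by
    rw [RCLike.star_def, Complex.mul_conj']; push_cast; rfl
  push_cast at this ⊢
  linear_combination ((st.weight ⟨l, m⟩ : ℂ) *
    ((st.streamNoise S l m)⁻¹ *ᵥ (N.H l l *ᵥ st.t l m)) i *
    star (((st.streamNoise S l m)⁻¹ *ᵥ (N.H l l *ᵥ st.t l m)) j)) * this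

theorem sum_weight_smul (h : st.IsDecomposition S) (hm : st.IsMMSE S) (l : Fin L) (j : ℕ)
    (hj : j ≤ st.M l) :
    ∑ n ∈ Finset.univ.filter fun n : Fin (st.M l) => (n : ℕ) < j,
        st.weight ⟨l, n⟩ • vecMulVec (st.r l n) (star (st.r l n)) =
      (st.tail S l j)⁻¹ - (N.totalCov S l)⁻¹ := by
  induction j with
  | zero => simp [tail_zero h]
  | succ j ih =>
    have : (Finset.univ.filter fun n : Fin (st.M l) => (n : ℕ) < j + 1) =
        insert ⟨j, hj⟩ (Finset.univ.filter fun n : Fin (st.M l) => (n : ℕ) < j) := by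
      ext i
      simp only [Finset.mem_filter, Finset.mem_univ, true_and, Finset.mem_insert, Fin.ext_iff]
      omega
    rw [this, Finset.sum_insert (by simp), ih (by omega), weight_smul h hm]
    simp

end BMAC.Strategy

/-! ### The covariance transformation of a stationary point -/

namespace BMAC

open Matrix

variable {L : ℕ} {N : BMAC L} {S : N.Cov}

/-- The reverse-link covariances `ν_l (Ω_l⁻¹ - (Ω_l + H_{l,l} Σ_l H_{l,l}†)⁻¹)`. Up to sign,
they are the derivatives of the weighted rates `ν_l I_l` with respect to `Ω_l`. -/
noncomputable def dualCov (N : BMAC L) (S : N.Cov) (ν : Fin L → ℝ) : N.RevCov := fun l =>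
  ν l • ((N.Omega S l)⁻¹ - (N.totalCov S l)⁻¹)

theorem dualCov_posSemidef (hS : ∀ l, (S l).PosSemidef) {ν : Fin L → ℝ} (hν : ∀ l, 0 ≤ ν l)
    (l : Fin L) : (N.dualCov S ν l).PosSemidef :=
  (posSemidef_inv_sub_inv_add (Omega_posDef hS l)
    ((hS l).mul_mul_conjTranspose_same _)).smul (hν l)

/-- `S` is stationary for `∑_l (ν_l log |I + Ω_l⁻¹ H_{l,l} Σ_l H_{l,l}†| - Tr (R_l Σ_l))`, where
the interference covariances `Ω_l` are kept fixed, over positive semidefinite `Σ_l`. -/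
def IsPriced (N : BMAC L) (S : N.Cov) (ν : Fin L → ℝ) (R : N.Cov) : Prop :=
  ∀ l, ∃ Θ : Matrix (Fin (N.nT l)) (Fin (N.nT l)) ℂ, Θ.PosSemidef ∧ Θ * S l = 0 ∧
    ν l • ((N.H l l)ᴴ * (N.totalCov S l)⁻¹ * N.H l l) + Θ = R l

namespace Strategy

variable {st : N.Strategy} {ν : Fin L → ℝ}

/-- A multiplier of `Σ_l ⪰ 0` vanishes on the transmit vectors of each decomposition. -/
theorem IsDecomposition.quad_eq_zero (h : st.IsDecomposition S) (l : Fin L)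
    {Θ : Matrix (Fin (N.nT l)) (Fin (N.nT l)) ℂ} (hΘ : Θ.PosSemidef) (h0 : Θ * S l = 0)
    (m : Fin (st.M l)) : star (st.t l m) ⬝ᵥ (Θ *ᵥ st.t l m) = 0 := by
  have h1 : ∑ m, st.p l m • (star (st.t l m) ⬝ᵥ (Θ *ᵥ st.t l m)) = 0 := by
    have := congrArg trace h0
    rw [h.2.2 l, Matrix.mul_sum, trace_sum, trace_zero] at this
    rw [← this]
    refine Finset.sum_congr rfl fun m _ => ?_
    rw [Matrix.mul_smul, trace_smul, mul_vecMulVec, trace_vecMulVec, dotProduct_comm]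
  have h2 := (Finset.sum_eq_zero_iff_of_nonneg fun m _ =>
    smul_nonneg (h.1 l m).le (hΘ.dotProduct_mulVec_nonneg (st.t l m))).1 h1 m (Finset.mem_univ m)
  exact (smul_eq_zero.1 h2).resolve_left (h.1 l m).ne'

theorem IsDecomposition.quad_of_isPriced (h : st.IsDecomposition S) {R : N.Cov}
    (hR : N.IsPriced S ν R) (l : Fin L) (m : Fin (st.M l)) :
    star (st.t l m) ⬝ᵥ (R l *ᵥ st.t l m) = ν l *
      (star (N.H l l *ᵥ st.t l m) ⬝ᵥ ((N.totalCov S l)⁻¹ *ᵥ (N.H l l *ᵥ st.t l m))) := by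
  obtain ⟨Θ, hΘ, h0, h1⟩ := hR l
  rw [← h1, add_mulVec, dotProduct_add, h.quad_eq_zero l hΘ h0, add_zero, smul_mulVec,
    dotProduct_smul, Complex.real_smul, ← mulVec_mulVec, ← mulVec_mulVec,
    dotProduct_mulVec _ (N.H l l)ᴴ, ← star_mulVec]

/-- The dual covariances are, for each decomposition with MMSE-SIC receivers, a combination of the
projections on the receive vectors. -/
theorem sum_eq_dualCov (h : st.IsDecomposition S) (hm : st.IsMMSE S) :
    st.covOf (fun a => ν a.1 * st.weight a) = N.dualCov S ν := by
  funext l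
  have := sum_weight_smul h hm l (st.M l) le_rfl
  rw [tail_last, Finset.filter_true_of_mem (fun i _ => i.2)] at this
  rw [dualCov, ← this, covOf, Finset.smul_sum]
  simp only [mul_smul]

/-- For a stream satisfying the stationarity condition, whose predecessors have the powers
`ν c` of the dual covariances, the reverse-link SINR equation has the unique solution `ν c`. -/
theorem revEquation_iff (h : st.IsDecomposition S) (hm : st.IsMMSE S) {q : st.Stream → ℝ}
    (hR : N.IsPriced S ν (N.revOmega (st.covOf q))) (l : Fin L) (m : Fin (st.M l))
    (hq : ∀ n < m, q ⟨l, n⟩ = ν l * st.weight ⟨l, n⟩) :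
    st.gain ⟨l, m⟩ ⟨l, m⟩ / st.sinr ⟨l, m⟩ * q ⟨l, m⟩ -
        ∑ b, st.crossTalk b ⟨l, m⟩ * q b = 1 ↔
      q ⟨l, m⟩ = ν l * st.weight ⟨l, m⟩ := by
  obtain ⟨α, s, hα, hs, hr, hsx, hg, hc⟩ := exists_mmse_scaling h hm l m
  have hp := h.1 l m
  have hps : (0 : ℝ) < 1 + st.p l m * s := by positivity
  -- reverse-link interference of the streams decoded earlier, by telescoping
  have e1 : ((∑ n ∈ Finset.Iio m, q ⟨l, n⟩ * st.gain ⟨l, n⟩ ⟨l, m⟩ : ℝ) : ℂ) =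
      ν l * (star (N.H l l *ᵥ st.t l m) ⬝ᵥ ((st.tail S l m)⁻¹ *ᵥ (N.H l l *ᵥ st.t l m))) -
      ν l * (star (N.H l l *ᵥ st.t l m) ⬝ᵥ
        ((N.totalCov S l)⁻¹ *ᵥ (N.H l l *ᵥ st.t l m))) := by
    rw [← mul_sub, ← dotProduct_sub, ← sub_mulVec, ← sum_weight_smul h hm l m m.2.le,
      sum_mulVec, dotProduct_sum, Finset.mul_sum, Complex.ofReal_sum]
    have hset : (Finset.univ.filter fun n : Fin (st.M l) => (n : ℕ) < m) = Finset.Iio m := by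
      ext n; simp
    rw [hset]
    refine Finset.sum_congr rfl fun n hn => ?_
    rw [hq n (Finset.mem_Iio.1 hn), smul_mulVec, dotProduct_smul, dotProduct_vecMulVec_mulVec,
      Complex.real_smul]
    simp only [gain]
    push_cast
    ring
  have e2 : star (N.H l l *ᵥ st.t l m) ⬝ᵥ ((st.tail S l m)⁻¹ *ᵥ (N.H l l *ᵥ st.t l m)) =
      ((s / (1 + st.p l m * s) : ℝ) : ℂ) := by
    have h1 := (streamNoise_posDef h l m).inv_sub_inv_add_vecMulVec _ hp.le hsx
    rw [← tail_eq_add, sub_eq_iff_eq_add, ← sub_eq_iff_eq_add'] at h1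
    rw [← h1, sub_mulVec, dotProduct_sub, hsx, smul_mulVec, dotProduct_smul,
      dotProduct_vecMulVec_mulVec, Complex.real_smul, ← Complex.ofReal_mul, ← Complex.ofReal_sub]
    have h2 : ‖star ((st.streamNoise S l m)⁻¹ *ᵥ (N.H l l *ᵥ st.t l m)) ⬝ᵥ
        (N.H l l *ᵥ st.t l m)‖ = s := by
      rw [star_mulVec, (streamNoise_posDef h l m).inv.isHermitian.eq, ← dotProduct_mulVec, hsx,
        Complex.norm_real, Real.norm_of_nonneg hs.le]
    rw [h2]
    congr 1
    field_simp
    ring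
  have e3 : 1 + ∑ b, st.crossTalk b ⟨l, m⟩ * q b = ν l * (s / (1 + st.p l m * s)) := by
    have h1 := h.quad_of_isPriced hR l m
    rw [quad_revOmega, h.2.1] at h1
    rw [sum_crossTalk_transpose]
    have h2 : ∀ k n, st.gain ⟨k, n⟩ ⟨l, m⟩ =
      ‖star (st.r k n) ⬝ᵥ (N.H k l *ᵥ st.t l m)‖ ^ 2 := fun _ _ => rfl
    simp only [← h2] at h1
    rw [e2] at e1
    rw [← Complex.ofReal_inj]
    push_cast at e1 h1 ⊢
    linear_combination e1 + h1
  rw [sub_eq_iff_eq_add, e3]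
  have hw : st.weight ⟨l, m⟩ = st.p l m / (‖α‖ ^ 2 * (1 + st.p l m * s)) := by
    simp only [weight, sinr, hg, hc]
    field_simp
  have hd : st.gain ⟨l, m⟩ ⟨l, m⟩ / st.sinr ⟨l, m⟩ = ‖α‖ ^ 2 * s / st.p l m := by
    simp only [sinr, hg, hc]
    field_simp
  rw [hw, hd]
  constructor
  · intro h1
    have : q ⟨l, m⟩ = (‖α‖ ^ 2 * s / st.p l m * q ⟨l, m⟩) * (st.p l m / (‖α‖ ^ 2 * s)) := by
      field_simp
    rw [this, h1]
    field_simp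
  · intro h1
    rw [h1]
    field_simp

theorem sinrDiag_inv (h : st.IsDecomposition S) (hm : st.IsMMSE S) :
    (st.sinrDiag)⁻¹ = diagonal fun a => st.gain a a / st.sinr a := by
  apply Matrix.inv_eq_right_inv
  rw [sinrDiag, diagonal_mul_diagonal, ← diagonal_one]
  congr 1
  funext ⟨l, m⟩
  obtain ⟨α, s, hα, hs, hr, hsx, hg, hc⟩ := exists_mmse_scaling h hm l m
  have hp := h.1 l m
  simp only [sinr, hg, hc]
  field_simp

/-- The forward powers solve `(D⁻¹ - Ψ) p = 1`. -/
theorem gain_div_sinr_mul (h : st.IsDecomposition S) (hm : st.IsMMSE S) (a : st.Stream) :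
    st.gain a a / st.sinr a * st.p a.1 a.2 = 1 + ∑ b, st.crossTalk a b * st.p b.1 b.2 := by
  obtain ⟨l, m⟩ := a
  obtain ⟨α, s, hα, hs, hr, hsx, hg, hc⟩ := exists_mmse_scaling h hm l m
  have hp := h.1 l m
  have : ∑ b : st.Stream, st.crossTalk ⟨l, m⟩ b * st.p b.1 b.2 =
      ∑ b : st.Stream, st.p b.1 b.2 * st.crossTalk ⟨l, m⟩ b :=
    Finset.sum_congr rfl fun _ _ => mul_comm _ _
  rw [this]
  simp only [sinr, hg, hc]
  field_simp

theorem isUnit_det_revEquation (h : st.IsDecomposition S) (hm : st.IsMMSE S) :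
    IsUnit ((st.sinrDiag)⁻¹ - (st.crossTalk)ᵀ).det := by
  rw [sinrDiag_inv h hm]
  exact isUnit_det_diagonal_sub_transpose crossTalk_nonneg (gain_div_sinr_mul h hm)
    fun a => h.1 a.1 a.2

theorem mulVec_revPower (h : st.IsDecomposition S) (hm : st.IsMMSE S) :
    ((st.sinrDiag)⁻¹ - (st.crossTalk)ᵀ) *ᵥ st.revPower = 1 := by
  rw [revPower, mulVec_mulVec, mul_nonsing_inv _ (isUnit_det_revEquation h hm), one_mulVec]

theorem eq_revPower (h : st.IsDecomposition S) (hm : st.IsMMSE S) {q : st.Stream → ℝ}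
    (hq : ((st.sinrDiag)⁻¹ - (st.crossTalk)ᵀ) *ᵥ q = 1) : st.revPower = q := by
  rw [revPower, ← hq, mulVec_mulVec, nonsing_inv_mul _ (isUnit_det_revEquation h hm), one_mulVec]

theorem revPower_nonneg (h : st.IsDecomposition S) (hm : st.IsMMSE S) (a : st.Stream) :
    0 ≤ st.revPower a := by
  have := mulVec_revPower h hm
  rw [sinrDiag_inv h hm] at this
  exact nonneg_of_diagonal_sub_transpose_mulVec crossTalk_nonneg (gain_div_sinr_mul h hm)
    (fun a => h.1 a.1 a.2) this a

theorem revCov_eq_covOf : st.revCov = st.covOf st.revPower := rfl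

theorem revCov_posSemidef (h : st.IsDecomposition S) (hm : st.IsMMSE S) (l : Fin L) :
    (st.revCov l).PosSemidef :=
  covOf_posSemidef (revPower_nonneg h hm) l

/-- At a stationary point, each covariance transformation equals the dual covariances. -/
theorem revCov_eq_of_isPriced_dualCov (h : st.IsDecomposition S) (hm : st.IsMMSE S)
    (hR : N.IsPriced S ν (N.revOmega (N.dualCov S ν))) : st.revCov = N.dualCov S ν := by
  rw [← sum_eq_dualCov h hm, revCov_eq_covOf]
  congr 1
  refine eq_revPower h hm ?_
  rw [sinrDiag_inv h hm]
  funext ⟨l, m⟩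
  rw [diagonal_sub_transpose_mulVec, Pi.one_apply]
  rw [← sum_eq_dualCov h hm] at hR
  exact (revEquation_iff h hm hR l m fun _ _ => rfl).2 rfl

/-- If the stationarity condition holds with the interference prices of a covariance
transformation, then this transformation equals the dual covariances. The powers are found
one after the other in the decoding order. -/
theorem revCov_eq_of_isPriced_revCov (h : st.IsDecomposition S) (hm : st.IsMMSE S)
    (hR : N.IsPriced S ν (N.revOmega st.revCov)) : st.revCov = N.dualCov S ν := by
  rw [← sum_eq_dualCov h hm, revCov_eq_covOf]
  rw [revCov_eq_covOf] at hR
  congr 1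
  have h1 := mulVec_revPower h hm
  rw [sinrDiag_inv h hm] at h1
  funext ⟨l, m⟩
  induction m using WellFoundedLT.induction with
  | ind m ih =>
    have h2 := congrFun h1 ⟨l, m⟩
    rw [diagonal_sub_transpose_mulVec, Pi.one_apply] at h2
    exact (revEquation_iff h hm hR l m ih).1 h2

end Strategy

end BMAC

/-! ### Polite water-filling and stationarity -/

namespace BMAC

open Matrix

variable {L : ℕ} {N : BMAC L} {S : N.Cov} {ν : Fin L → ℝ}

theorem IsCovTransform.posSemidef {S' : N.RevCov} (h : N.IsCovTransform S S') (l : Fin L) :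
    (S l).PosSemidef := by
  obtain ⟨st, hd, -, -⟩ := h
  exact hd.posSemidef l

theorem isWaterFilling_iff_isPriced {S' : N.RevCov} (hS : ∀ l, (S l).PosSemidef)
    (hS' : ∀ l, (S' l).PosSemidef) :
    (∀ l, IsWaterFilling
      ((CFC.sqrt (N.Omega S l))⁻¹ * N.H l l * (CFC.sqrt (N.revOmega S' l))⁻¹)
      (CFC.sqrt (N.revOmega S' l) * S l * CFC.sqrt (N.revOmega S' l)) (ν l)) ↔
    N.IsPriced S ν (N.revOmega S') :=
  forall_congr' fun l =>
    isWaterFilling_whitened_iff (Omega_posDef hS l) (revOmega_posDef hS' l) (hS l)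

theorem HasPoliteWaterFilling.isPriced {S' : N.RevCov} (h : N.HasPoliteWaterFilling S S' ν) :
    N.IsPriced S ν (N.revOmega (N.dualCov S ν)) := by
  obtain ⟨⟨st, hd, hm, rfl⟩, h2⟩ := h
  have h3 := (isWaterFilling_iff_isPriced (ν := ν) hd.posSemidef
    (Strategy.revCov_posSemidef hd hm)).1 fun l => (h2 l).2
  rwa [Strategy.revCov_eq_of_isPriced_revCov hd hm h3] at h3

theorem IsPriced.hasPoliteWaterFilling (hR : N.IsPriced S ν (N.revOmega (N.dualCov S ν)))
    (hν : ∀ l, 0 ≤ ν l) {S' : N.RevCov} (h : N.IsCovTransform S S') :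
    N.HasPoliteWaterFilling S S' ν := by
  refine ⟨h, ?_⟩
  obtain ⟨st, hd, hm, rfl⟩ := h
  have h3 := Strategy.revCov_eq_of_isPriced_dualCov hd hm hR
  have h4 := (isWaterFilling_iff_isPriced (ν := ν) hd.posSemidef
    (Strategy.revCov_posSemidef hd hm)).2 (h3.symm ▸ hR)
  exact fun l => ⟨hν l, h4 l⟩

theorem exists_rankOne_decomposition {n : ℕ} {A : Matrix (Fin n) (Fin n) ℂ}
    (hA : A.PosSemidef) : ∃ (M : ℕ) (p : Fin M → ℝ) (t : Fin M → Fin n → ℂ),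
      (∀ m, 0 < p m) ∧ (∀ m, star (t m) ⬝ᵥ t m = 1) ∧
      A = ∑ m, p m • vecMulVec (t m) (star (t m)) := by
  obtain ⟨U, a, hUU, hUU', hev⟩ := hA.isHermitian.exists_unitary_eigenvectors
  have hnorm : ∀ i, star (fun r => U r i) ⬝ᵥ (fun r => U r i) = 1 := by
    intro i
    rw [← one_apply_eq (α := ℂ) i, ← hUU']; simp [mul_apply, dotProduct]
  have ha : ∀ i, 0 ≤ a i := by
    intro i
    have h1 := hA.dotProduct_mulVec_nonneg (fun r => U r i)
    rw [hev, dotProduct_smul, hnorm] at h1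
    simpa using h1
  obtain ⟨k, e, -, hae, hsum⟩ := exists_fin_enum_ne_zero a
  refine ⟨k, fun j => a (e j), fun j r => U r (e j), fun j => lt_of_le_of_ne (ha _) (hae j).symm,
    fun j => hnorm _, ?_⟩
  rw [hsum (fun i => a i • vecMulVec (fun r => U r i) (star fun r => U r i))
    (fun i hi => by rw [hi, zero_smul])]
  conv_lhs => rw [← sum_vecMulVec_eq_of_unitary hUU A]
  refine Finset.sum_congr rfl fun i _ => ?_
  rw [hev, smul_vecMulVec]
  rfl

/-- A covariance transformation exists as soon as no transmit vector lies in the kernel of its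
channel, which stationarity rules out. -/
theorem IsPriced.exists_isCovTransform (hS : ∀ l, (S l).PosSemidef) {S' : N.RevCov}
    (hS' : ∀ l, (S' l).PosSemidef) (hR : N.IsPriced S ν (N.revOmega S')) :
    ∃ T : N.RevCov, N.IsCovTransform S T := by
  choose M p t hp ht hdec using fun l => exists_rankOne_decomposition (hS l)
  let st₀ : N.Strategy := ⟨M, p, t, fun _ _ => 0⟩
  have hd₀ : st₀.IsDecomposition S := ⟨hp, ht, hdec⟩
  -- a transmit vector in the kernel of the channel would have price at least one and no rate
  have hne : ∀ l m, N.H l l *ᵥ t l m ≠ 0 := by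
    intro l m h0
    have h1 := hd₀.quad_of_isPriced hR l m
    have h2 := (revOmega_posDef hS' l).dotProduct_mulVec_pos (x := t l m) (by
      intro h; have := ht l m; rw [h] at this; simp at this)
    change star (t l m) ⬝ᵥ (N.revOmega S' l *ᵥ t l m) = ν l *
      (star (N.H l l *ᵥ t l m) ⬝ᵥ ((N.totalCov S l)⁻¹ *ᵥ (N.H l l *ᵥ t l m))) at h1
    rw [h1, h0] at h2
    simp at h2
  have hu : ∀ l m, ∃ a : ℂ, star (a • ((st₀.streamNoise S l m)⁻¹ *ᵥ (N.H l l *ᵥ t l m))) ⬝ᵥ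
      (a • ((st₀.streamNoise S l m)⁻¹ *ᵥ (N.H l l *ᵥ t l m))) = 1 := by
    intro l m
    have hW := Strategy.streamNoise_posDef hd₀ l m
    have hu0 : (st₀.streamNoise S l m)⁻¹ *ᵥ (N.H l l *ᵥ t l m) ≠ 0 := by
      intro h0
      have := congrArg (fun v => st₀.streamNoise S l m *ᵥ v) h0
      simp only [mulVec_mulVec _ (st₀.streamNoise S l m), hW.mul_inv', one_mulVec,
        mulVec_zero] at this
      exact hne l m this
    generalize (st₀.streamNoise S l m)⁻¹ *ᵥ (N.H l l *ᵥ t l m) = u at hu0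
    have h1 : (0 : ℂ) < star u ⬝ᵥ u := dotProduct_star_self_pos_iff.2 hu0
    have h2 : star u ⬝ᵥ u = ((star u ⬝ᵥ u).re : ℂ) := Complex.eq_re_of_ofReal_le h1.le
    generalize (star u ⬝ᵥ u).re = s at h2
    rw [h2] at h1
    have hs : 0 < s := by exact_mod_cast h1
    refine ⟨((Real.sqrt s)⁻¹ : ℝ), ?_⟩
    rw [star_smul, smul_dotProduct, dotProduct_smul, h2, RCLike.star_def, Complex.conj_ofReal,
      smul_eq_mul, smul_eq_mul]
    norm_cast
    have : Real.sqrt s ≠ 0 := (Real.sqrt_pos.2 hs).ne'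
    field_simp
    exact (Real.sq_sqrt hs.le).symm
  choose a ha using hu
  let st : N.Strategy := ⟨M, p, t,
    fun l m => a l m • ((st₀.streamNoise S l m)⁻¹ *ᵥ (N.H l l *ᵥ t l m))⟩
  exact ⟨st.revCov, st, ⟨hp, ht, hdec⟩, fun l m => ⟨ha l m, a l m, rfl⟩, rfl⟩

end BMAC

/-! ### Derivatives of the rates -/

namespace Matrix

theorem hasDerivWithinAt_mul_mul {n m k l : Type*} [Fintype m] [Fintype k] {A : ℝ → Matrix m k ℂ}
    {A' : Matrix m k ℂ} {s : Set ℝ} {x : ℝ} (B : Matrix n m ℂ) (C : Matrix k l ℂ)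
    (hA : ∀ i j, HasDerivWithinAt (fun y => A y i j) (A' i j) s x) (i : n) (j : l) :
    HasDerivWithinAt (fun y => (B * A y * C) i j) ((B * A' * C) i j) s x := by
  simp only [mul_apply]
  exact HasDerivWithinAt.fun_sum fun b _ =>
    (HasDerivWithinAt.fun_sum fun a _ => (hA a b).const_mul _).mul_const _

variable {n : Type*} [Fintype n] [DecidableEq n]

theorem hasDerivWithinAt_det_one {A : ℝ → Matrix n n ℂ} {A' : Matrix n n ℂ} {s : Set ℝ} {x : ℝ}
    (hA : ∀ i j, HasDerivWithinAt (fun y => A y i j) (A' i j) s x) (h1 : A x = 1) :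
    HasDerivWithinAt (fun y => (A y).det) A'.trace s x := by
  simp only [det_apply']
  have h : ∀ σ : Equiv.Perm n, HasDerivWithinAt
      (fun y => ((Equiv.Perm.sign σ : ℤ) : ℂ) * ∏ i, A y (σ i) i)
      (((Equiv.Perm.sign σ : ℤ) : ℂ) *
        ∑ i, (∏ j ∈ Finset.univ.erase i, A x (σ j) j) • A' (σ i) i) s x := by
    intro σ
    exact (HasDerivWithinAt.fun_finsetProd fun i _ => hA (σ i) i).const_mul _
  have h2 := HasDerivWithinAt.fun_sum (u := Finset.univ) fun σ _ => h σ
  refine h2.congr_deriv ?_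
  rw [Finset.sum_eq_single 1]
  · simp only [Equiv.Perm.sign_one, Units.val_one, Int.cast_one, one_mul, Equiv.Perm.one_apply, h1,
      one_apply_eq, Finset.prod_const_one, one_smul]
    rfl
  · intro σ _ hσ
    rw [Finset.sum_eq_zero, mul_zero]
    intro i _
    -- a nontrivial permutation moves some point other than `i`
    obtain ⟨j, hj⟩ : ∃ j, σ j ≠ j := by
      by_contra hcon; push Not at hcon; exact hσ (Equiv.ext hcon)
    have : ∃ j, j ≠ i ∧ σ j ≠ j := by
      by_cases hji : j = i
      · exact ⟨σ j, fun h => hj (h.trans hji.symm), fun h => hj (σ.injective h)⟩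
      · exact ⟨j, hji, hj⟩
    obtain ⟨j, hji, hj⟩ := this
    rw [Finset.prod_eq_zero (Finset.mem_erase.2 ⟨hji, Finset.mem_univ j⟩), zero_smul]
    rw [h1, one_apply_ne hj]
  · simp

/-- Jacobi's formula along a curve through an invertible matrix. -/
theorem hasDerivWithinAt_det {A : ℝ → Matrix n n ℂ} {A' : Matrix n n ℂ} {s : Set ℝ} {x : ℝ}
    (hA : ∀ i j, HasDerivWithinAt (fun y => A y i j) (A' i j) s x) (hu : IsUnit (A x).det) :
    HasDerivWithinAt (fun y => (A y).det) ((A x).det * ((A x)⁻¹ * A').trace) s x := by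
  have h1 := hasDerivWithinAt_det_one (A := fun y => (A x)⁻¹ * A y * 1)
    (hasDerivWithinAt_mul_mul (A x)⁻¹ 1 hA) (by rw [Matrix.mul_one, nonsing_inv_mul _ hu])
  have h2 := h1.const_mul (A x).det
  simp only [Matrix.mul_one] at h2
  refine h2.congr_of_eventuallyEq (.of_forall fun y => ?_) ?_
  · beta_reduce
    rw [← det_mul, ← Matrix.mul_assoc, mul_nonsing_inv _ hu, Matrix.one_mul]
  · rw [← det_mul, ← Matrix.mul_assoc, mul_nonsing_inv _ hu, Matrix.one_mul]

end Matrix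

namespace BMAC

open Matrix

variable {L : ℕ} {N : BMAC L} {S : N.Cov}

/-- The interference covariance `∑_k Φ_{l,k} H_{l,k} X_k H_{l,k}†`. -/
noncomputable def interf (N : BMAC L) (X : N.Cov) (l : Fin L) :
    Matrix (Fin (N.nR l)) (Fin (N.nR l)) ℂ :=
  ∑ k, N.Φ l k • (N.H l k * X k * (N.H l k)ᴴ)

theorem Omega_eq (S : N.Cov) (l : Fin L) : N.Omega S l = 1 + N.interf S l := rfl

/-- Derivative of the rate of link `l` at `S` in the direction `X`. -/
noncomputable def rateDeriv (N : BMAC L) (S X : N.Cov) (l : Fin L) : ℝ :=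
  ((N.totalCov S l)⁻¹ * (N.interf X l + N.H l l * X l * (N.H l l)ᴴ)).trace.re -
    ((N.Omega S l)⁻¹ * N.interf X l).trace.re

theorem hasDerivWithinAt_Omega {c : ℝ → N.Cov} {v : N.Cov} {s : Set ℝ} {x : ℝ}
    (hc : ∀ l i j, HasDerivWithinAt (fun y => c y l i j) (v l i j) s x) (l : Fin L) (i j) :
    HasDerivWithinAt (fun y => N.Omega (c y) l i j) (N.interf v l i j) s x := by
  simp only [Omega_eq, interf, Matrix.add_apply, Matrix.sum_apply, Matrix.smul_apply]
  exact (HasDerivWithinAt.fun_sum fun k _ =>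
    (hasDerivWithinAt_mul_mul (N.H l k) (N.H l k)ᴴ (hc k) i j).const_smul (N.Φ l k)).const_add _

theorem hasDerivWithinAt_totalCov {c : ℝ → N.Cov} {v : N.Cov} {s : Set ℝ} {x : ℝ}
    (hc : ∀ l i j, HasDerivWithinAt (fun y => c y l i j) (v l i j) s x) (l : Fin L) (i j) :
    HasDerivWithinAt (fun y => N.totalCov (c y) l i j)
      ((N.interf v l + N.H l l * v l * (N.H l l)ᴴ) i j) s x :=
  (hasDerivWithinAt_Omega hc l i j).add (hasDerivWithinAt_mul_mul _ _ (hc l) i j)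

theorem rate_eq_of_isUnit (l : Fin L) (h : IsUnit (N.Omega S l).det) :
    N.rate S l = Real.log ((N.totalCov S l).det / (N.Omega S l).det).re := by
  rw [rate]
  have : 1 + N.H l l * S l * (N.H l l)ᴴ * (N.Omega S l)⁻¹ =
      N.totalCov S l * (N.Omega S l)⁻¹ := by
    rw [totalCov, Matrix.add_mul, mul_nonsing_inv _ h]
  rw [this, det_mul, det_nonsing_inv, Ring.inverse_eq_inv', div_eq_mul_inv]

theorem hasDerivWithinAt_rate (hS : ∀ l, (S l).PosSemidef) {c : ℝ → N.Cov} {v : N.Cov}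
    {s : Set ℝ} {x : ℝ} (hc : ∀ l i j, HasDerivWithinAt (fun y => c y l i j) (v l i j) s x)
    (hx : c x = S) (l : Fin L) :
    HasDerivWithinAt (fun y => N.rate (c y) l) (N.rateDeriv S v l) s x := by
  have hO := Omega_posDef hS l
  have hT := totalCov_posDef hS l
  have hOp : 0 < (N.Omega S l).det := hO.det_pos
  have hTp : 0 < (N.totalCov S l).det := hT.det_pos
  have h1 := hasDerivWithinAt_det (hasDerivWithinAt_Omega hc l) (by
    rw [hx]; exact isUnit_iff_ne_zero.2 hOp.ne')
  have h2 := hasDerivWithinAt_det (hasDerivWithinAt_totalCov hc l) (by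
    rw [hx]; exact isUnit_iff_ne_zero.2 hTp.ne')
  have hne : (N.Omega (c x) l).det ≠ 0 := by rw [hx]; exact hOp.ne'
  have h3 := h2.fun_div h1 hne
  have h4 := Complex.reCLM.hasFDerivAt.comp_hasDerivWithinAt x h3
  have hor : (N.Omega S l).det = ((N.Omega S l).det.re : ℂ) := Complex.eq_re_of_ofReal_le hOp.le
  have htr : (N.totalCov S l).det = ((N.totalCov S l).det.re : ℂ) :=
    Complex.eq_re_of_ofReal_le hTp.le
  generalize (N.Omega S l).det.re = o at hor
  generalize (N.totalCov S l).det.re = t at htr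
  rw [hor] at hOp
  rw [htr] at hTp
  have ho : 0 < o := by exact_mod_cast hOp
  have ht : 0 < t := by exact_mod_cast hTp
  have hval : ((N.totalCov (c x) l).det / (N.Omega (c x) l).det).re = t / o := by
    rw [hx, hor, htr, ← Complex.ofReal_div, Complex.ofReal_re]
  have h5 := HasDerivWithinAt.log h4 (by
    simp only [Function.comp, Complex.reCLM_apply]
    rw [hval]; positivity)
  have hev : ∀ᶠ y in nhdsWithin x s, (N.Omega (c y) l).det ≠ 0 :=
    h1.continuousWithinAt.eventually_ne hne
  refine (h5.congr_of_eventuallyEq (hev.mono fun y hy =>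
    rate_eq_of_isUnit l (isUnit_iff_ne_zero.2 hy)) (rate_eq_of_isUnit l
      (isUnit_iff_ne_zero.2 hne))).congr_deriv ?_
  simp only [Function.comp, Complex.reCLM_apply]
  rw [hval, hx, hor, htr, rateDeriv]
  have hoC : (o : ℂ) ≠ 0 := by exact_mod_cast ho.ne'
  generalize ((N.totalCov S l)⁻¹ * (N.interf v l + N.H l l * v l * (N.H l l)ᴴ)).trace = a
  generalize ((N.Omega S l)⁻¹ * N.interf v l).trace = b
  have : ((t : ℂ) * a * o - t * (o * b)) / (o : ℂ) ^ 2 = ((t / o : ℝ) : ℂ) * (a - b) := by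
    push_cast; field_simp
  rw [this, Complex.re_ofReal_mul, Complex.sub_re]
  have := ht.ne'
  field_simp

theorem rateDeriv_eq (S X : N.Cov) (l : Fin L) : N.rateDeriv S X l =
    ((N.H l l)ᴴ * (N.totalCov S l)⁻¹ * N.H l l * X l).trace.re -
      ∑ k, (N.Φ l k • ((N.H l k)ᴴ * ((N.Omega S l)⁻¹ - (N.totalCov S l)⁻¹) * N.H l k) *
        X k).trace.re := by
  have hcyc : ∀ k (B : Matrix (Fin (N.nR l)) (Fin (N.nR l)) ℂ),
      (B * (N.H l k * X k * (N.H l k)ᴴ)).trace = ((N.H l k)ᴴ * B * N.H l k * X k).trace := by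
    intro k B
    rw [Matrix.mul_assoc (N.H l k), ← Matrix.mul_assoc B, Matrix.trace_mul_comm]
    rw [Matrix.mul_assoc (X k), Matrix.trace_mul_comm]
    simp only [Matrix.mul_assoc]
  have h1 : ∑ k, (N.Φ l k • ((N.H l k)ᴴ * ((N.Omega S l)⁻¹ - (N.totalCov S l)⁻¹) * N.H l k) *
        X k).trace.re = (((N.Omega S l)⁻¹ - (N.totalCov S l)⁻¹) * N.interf X l).trace.re := by
    rw [interf, Matrix.mul_sum, trace_sum, Complex.re_sum]
    refine Finset.sum_congr rfl fun k _ => ?_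
    rw [Matrix.smul_mul, Matrix.mul_smul, trace_smul, trace_smul, hcyc]
  rw [h1, rateDeriv, Matrix.mul_add, trace_add, hcyc, Matrix.sub_mul, trace_sub, Complex.add_re,
    Complex.sub_re]
  ring

theorem rateDeriv_add (S X Y : N.Cov) (l : Fin L) :
    N.rateDeriv S (X + Y) l = N.rateDeriv S X l + N.rateDeriv S Y l := by
  simp only [rateDeriv_eq, Pi.add_apply, Matrix.mul_add, trace_add, Complex.add_re,
    Finset.sum_add_distrib]
  ring

theorem rateDeriv_smul (S X : N.Cov) (r : ℝ) (l : Fin L) :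
    N.rateDeriv S (r • X) l = r * N.rateDeriv S X l := by
  simp only [rateDeriv_eq, Pi.smul_apply, Matrix.mul_smul, trace_smul, Complex.smul_re,
    smul_eq_mul, ← Finset.mul_sum]
  ring

/-- Gradient of the weighted sum rate with weights `w`: it is the difference of the terms of
the stationarity condition for the interference prices of the dual covariances. -/
theorem sum_rateDeriv (S X : N.Cov) (w : Fin L → ℝ) : ∑ l, w l * N.rateDeriv S X l =
    ∑ l, ((w l • ((N.H l l)ᴴ * (N.totalCov S l)⁻¹ * N.H l l) + 1 -
      N.revOmega (N.dualCov S w) l) * X l).trace.re := by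
  have h1 : ∀ k, ((1 - N.revOmega (N.dualCov S w) k) * X k).trace.re = -∑ l, w l *
      (N.Φ l k • ((N.H l k)ᴴ * ((N.Omega S l)⁻¹ - (N.totalCov S l)⁻¹) * N.H l k) *
        X k).trace.re := by
    intro k
    rw [revOmega, sub_add_cancel_left, Matrix.neg_mul, trace_neg, Complex.neg_re, Matrix.sum_mul,
      trace_sum, Complex.re_sum]
    congr 1
    refine Finset.sum_congr rfl fun l _ => ?_
    simp only [dualCov, Matrix.mul_smul, Matrix.smul_mul, trace_smul, Complex.smul_re,
      smul_eq_mul]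
    ring
  simp only [add_sub_assoc, Matrix.add_mul, trace_add, Complex.add_re, h1, Finset.sum_add_distrib,
    rateDeriv_eq, mul_sub, Finset.sum_sub_distrib, Finset.mul_sum, Finset.sum_neg_distrib]
  rw [Finset.sum_comm (f := fun k l => w l * _), sub_eq_add_neg]
  congr 1
  refine Finset.sum_congr rfl fun l _ => ?_
  rw [Matrix.smul_mul, trace_smul, Complex.smul_re, smul_eq_mul]

/-- In the direction `S` itself, `dΩ = Ω - I` and the derivative of the total covariance is that
covariance minus `I`, so that the traces of the identities cancel. -/
theorem rateDeriv_self (hS : ∀ l, (S l).PosSemidef) (l : Fin L) :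
    N.rateDeriv S S l = ((N.Omega S l)⁻¹ - (N.totalCov S l)⁻¹).trace.re := by
  have h1 : N.interf S l = N.Omega S l - 1 := by rw [Omega_eq]; abel
  have h2 : N.Omega S l - 1 + N.H l l * S l * (N.H l l)ᴴ = N.totalCov S l - 1 := by
    rw [totalCov]; abel
  rw [rateDeriv, h1, h2, Matrix.mul_sub, Matrix.mul_sub, (totalCov_posDef hS l).inv_mul',
    (Omega_posDef hS l).inv_mul', Matrix.mul_one, Matrix.mul_one, ← Complex.sub_re, ← trace_sub]
  congr 2
  abel

/-- Scaling up all input covariances strictly increases each nonzero rate. -/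
theorem rateDeriv_self_pos (hS : ∀ l, (S l).PosSemidef) (l : Fin L) (h : N.rate S l ≠ 0) :
    0 < N.rateDeriv S S l := by
  rw [rateDeriv_self hS]
  have hK : N.H l l * S l * (N.H l l)ᴴ ≠ 0 := by
    intro h0
    refine h ?_
    rw [rate, h0]; simp
  exact (Complex.pos_iff.1 (trace_inv_sub_inv_add_pos (Omega_posDef hS l)
    ((hS l).mul_mul_conjTranspose_same _) hK)).1

end BMAC

/-! ### Stationarity implies the KKT conditions -/

/-- One-sided first-order condition: if `0 ≤ g` to the right of `0` and `g 0 = 0`, then the right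
derivative of `g` at `0` is nonnegative. -/
theorem HasDerivWithinAt.nonneg_of_nonneg_right {g : ℝ → ℝ} {d : ℝ}
    (hg : HasDerivWithinAt g d (Set.Ici 0) 0) (h0 : g 0 = 0)
    (h : ∀ᶠ s in 𝓝[≥] (0 : ℝ), 0 ≤ g s) : 0 ≤ d := by
  have h1 := (hasDerivWithinAt_iff_tendsto_slope' Set.self_notMem_Ioi).1 hg.Ioi_of_Ici
  refine ge_of_tendsto h1 ?_
  filter_upwards [h.filter_mono (nhdsWithin_mono _ Set.Ioi_subset_Ici_self),
    self_mem_nhdsWithin] with s hs hs0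
  rw [slope_def_field, h0, sub_zero, sub_zero]
  exact div_nonneg hs (le_of_lt hs0)

namespace BMAC

open Matrix

variable {L : ℕ} {N : BMAC L} {S : N.Cov} {ν : Fin L → ℝ} {Θ : N.Cov}

theorem hasDerivWithinAt_matrix_apply {m n : ℕ} {c : ℝ → Matrix (Fin m) (Fin n) ℂ}
    {v : Matrix (Fin m) (Fin n) ℂ} {s : Set ℝ} {x : ℝ} (hc : HasDerivWithinAt c v s x) (i j) :
    HasDerivWithinAt (fun y => c y i j) (v i j) s x := by
  have h : HasDerivWithinAt (F := Fin m → Fin n → ℂ) c v s x := hc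
  exact hasDerivWithinAt_pi.1 (hasDerivWithinAt_pi.1 h i) j

theorem hasDerivWithinAt_apply {c : ℝ → N.Cov} {v : N.Cov} {s : Set ℝ} {x : ℝ}
    (hc : HasDerivWithinAt c v s x) (l : Fin L) (i j) :
    HasDerivWithinAt (fun y => c y l i j) (v l i j) s x := by
  -- any norm inducing the product topology on matrices gives access to the componentwise criterion
  let : ∀ l : Fin L, NormedAddCommGroup (Matrix (Fin (N.nT l)) (Fin (N.nT l)) ℂ) :=
    fun _ => Matrix.normedAddCommGroup
  let : ∀ l : Fin L, NormedSpace ℝ (Matrix (Fin (N.nT l)) (Fin (N.nT l)) ℂ) :=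
    fun _ => Matrix.normedSpace
  exact hasDerivWithinAt_matrix_apply (hasDerivWithinAt_pi.1 hc l) i j

theorem hasDerivWithinAt_line (S X : N.Cov) (s : Set ℝ) (x : ℝ) (l : Fin L) (i j) :
    HasDerivWithinAt (fun y : ℝ => (S + y • X) l i j) (X l i j) s x := by
  have h := ((hasDerivWithinAt_id x s).smul_const (X l i j)).const_add (S l i j)
  rw [one_smul] at h
  exact h

theorem hasDerivWithinAt_trace_mul {c : ℝ → N.Cov} {v : N.Cov} {s : Set ℝ} {x : ℝ}
    (hc : ∀ l i j, HasDerivWithinAt (fun y => c y l i j) (v l i j) s x) (Θ : N.Cov) :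
    HasDerivWithinAt (fun y => ∑ l, (c y l * Θ l).trace.re) (∑ l, (v l * Θ l).trace.re) s x := by
  refine HasDerivWithinAt.fun_sum fun l _ => ?_
  refine Complex.reCLM.hasFDerivAt.comp_hasDerivWithinAt x (f := fun y => (c y l * Θ l).trace) ?_
  simp only [trace, diag, mul_apply]
  exact HasDerivWithinAt.fun_sum fun i _ => HasDerivWithinAt.fun_sum fun j _ =>
    (hc l i j).mul_const _

theorem hasDerivWithinAt_power {c : ℝ → N.Cov} {v : N.Cov} {s : Set ℝ} {x : ℝ}
    (hc : ∀ l i j, HasDerivWithinAt (fun y => c y l i j) (v l i j) s x) :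
    HasDerivWithinAt (fun y => N.power (c y)) (N.power v) s x := by
  have := hasDerivWithinAt_trace_mul hc (fun _ => 1)
  simpa only [Matrix.mul_one, ← power.eq_def] using this

theorem power_add (X Y : N.Cov) : N.power (X + Y) = N.power X + N.power Y := by
  simp [power, trace_add, Finset.sum_add_distrib]

theorem power_smul (r : ℝ) (X : N.Cov) : N.power (r • X) = r * N.power X := by
  simp [power, trace_smul, Finset.mul_sum]

theorem sum_trace_mul_nonneg {T : N.Cov} (hT : ∀ l, (T l).PosSemidef)
    (hΘ : ∀ l, (Θ l).PosSemidef) : 0 ≤ ∑ l, (T l * Θ l).trace.re :=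
  Finset.sum_nonneg fun l _ => (Complex.nonneg_iff.1 ((hT l).trace_mul_nonneg (hΘ l))).1

theorem sum_trace_mul_eq_zero (hΘS : ∀ l, Θ l * S l = 0) : ∑ l, (S l * Θ l).trace.re = 0 :=
  Finset.sum_eq_zero fun l _ => by rw [Matrix.trace_mul_comm, hΘS l]; simp

/-- The gradient of the weighted sum rate at a stationary point. -/
theorem sum_rateDeriv_of_isPriced
    (h : ∀ l, ν l • ((N.H l l)ᴴ * (N.totalCov S l)⁻¹ * N.H l l) + Θ l =
      N.revOmega (N.dualCov S ν) l) (X : N.Cov) :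
    ∑ l, ν l * N.rateDeriv S X l = N.power X - ∑ l, (X l * Θ l).trace.re := by
  rw [sum_rateDeriv, power, ← Finset.sum_sub_distrib]
  refine Finset.sum_congr rfl fun l _ => ?_
  rw [← h l, add_sub_add_left_eq_sub, Matrix.sub_mul, Matrix.one_mul, trace_sub, Complex.sub_re,
    Matrix.trace_mul_comm (Θ l)]

/-- A link with level zero would have the positive definite multiplier `Ω̂_l`, hence no power. -/
theorem pos_of_isPriced (hS : ∀ l, (S l).PosSemidef) (hν : ∀ l, 0 ≤ ν l)
    (h : N.IsPriced S ν (N.revOmega (N.dualCov S ν))) (l : Fin L) (hr : N.rate S l ≠ 0) :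
    0 < ν l := by
  refine lt_of_le_of_ne (hν l) fun h0 => hr ?_
  obtain ⟨Θ, -, hΘS, hΘ⟩ := h l
  rw [← h0, zero_smul, zero_add] at hΘ
  have hR := revOmega_posDef (dualCov_posSemidef hS hν) l
  have hS0 : S l = 0 := by
    rw [← Matrix.one_mul (S l), ← hR.inv_mul', Matrix.mul_assoc, ← hΘ, hΘS, Matrix.mul_zero]
  rw [rate, hS0]; simp

theorem hasDerivWithinAt_lagrSPMP (hS : ∀ l, (S l).PosSemidef)
    (h : ∀ l, ν l • ((N.H l l)ᴴ * (N.totalCov S l)⁻¹ * N.H l l) + Θ l =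
      N.revOmega (N.dualCov S ν) l) (I₀ : Fin L → ℝ) {c : ℝ → N.Cov} {v : N.Cov}
    {s : Set ℝ} {x : ℝ} (hc : ∀ l i j, HasDerivWithinAt (fun y => c y l i j) (v l i j) s x)
    (hx : c x = S) : HasDerivWithinAt (fun y => N.lagrSPMP I₀ ν Θ (c y)) 0 s x := by
  refine (((hasDerivWithinAt_power hc).sub (HasDerivWithinAt.fun_sum fun l _ =>
    ((hasDerivWithinAt_rate hS hc hx l).sub_const (I₀ l)).const_mul (ν l))).sub
    (hasDerivWithinAt_trace_mul hc Θ)).congr_deriv ?_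
  rw [sum_rateDeriv_of_isPriced h]
  ring

theorem add_sum_erase_mul_sub [NeZero L] {lam : Fin L → ℝ} (hlam : ∑ l, lam l = 1)
    (x : Fin L → ℝ) :
    x 0 + ∑ l ∈ Finset.univ.erase 0, lam l * (x l - x 0) = ∑ l, lam l * x l := by
  simp only [mul_sub, Finset.sum_sub_distrib, ← Finset.sum_mul]
  have h1 := Finset.add_sum_erase Finset.univ lam (Finset.mem_univ 0)
  have h2 := Finset.add_sum_erase Finset.univ (fun l => lam l * x l) (Finset.mem_univ 0)
  rw [hlam] at h1
  rw [← h2]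
  linear_combination -(x 0) * h1

theorem hasDerivWithinAt_lagrFOPa [NeZero L] (hS : ∀ l, (S l).PosSemidef)
    (h : ∀ l, ν l • ((N.H l l)ᴴ * (N.totalCov S l)⁻¹ * N.H l l) + Θ l =
      N.revOmega (N.dualCov S ν) l) {I₀ : Fin L → ℝ} (hI : ∀ l, 0 < I₀ l) (P : ℝ)
    {κ : ℝ} (hκ : 0 < κ) (hκν : κ = ∑ l, ν l * I₀ l) {c : ℝ → N.Cov} {v : N.Cov}
    {s : Set ℝ} {x : ℝ} (hc : ∀ l i j, HasDerivWithinAt (fun y => c y l i j) (v l i j) s x)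
    (hx : c x = S) :
    HasDerivWithinAt (fun y => N.lagrFOPa I₀ P (fun l => ν l * I₀ l / κ) κ⁻¹ (κ⁻¹ • Θ) (c y))
      0 s x := by
  have hr := fun l => (hasDerivWithinAt_rate hS hc hx l).div_const (I₀ l)
  refine ((((hr 0).add (HasDerivWithinAt.fun_sum fun l _ =>
    ((hr l).sub (hr 0)).const_mul (ν l * I₀ l / κ))).add
    (((hasDerivWithinAt_power hc).const_sub P).const_mul κ⁻¹)).add
    (hasDerivWithinAt_trace_mul hc (κ⁻¹ • Θ))).congr_deriv ?_
  rw [add_sum_erase_mul_sub (by rw [← Finset.sum_div, ← hκν, div_self hκ.ne'])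
    (fun l => N.rateDeriv S v l / I₀ l)]
  have e1 : ∑ l, ν l * I₀ l / κ * (N.rateDeriv S v l / I₀ l) =
      κ⁻¹ * ∑ l, ν l * N.rateDeriv S v l := by
    rw [Finset.mul_sum]
    refine Finset.sum_congr rfl fun l _ => ?_
    have := (hI l).ne'
    field_simp
  have e2 : ∑ l, (v l * (κ⁻¹ • Θ) l).trace.re = κ⁻¹ * ∑ l, (v l * Θ l).trace.re := by
    rw [Finset.mul_sum]
    refine Finset.sum_congr rfl fun l _ => ?_
    rw [Pi.smul_apply, Matrix.mul_smul, trace_smul, Complex.smul_re, smul_eq_mul]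
  rw [e1, e2, sum_rateDeriv_of_isPriced h]
  ring

/-- First-order bound for a concave weighted sum rate at a stationary point: the weighted sum
rate grows at most as fast as the sum power. -/
theorem sum_rate_sub_le_of_concave (hS : ∀ l, (S l).PosSemidef)
    (h : ∀ l, ν l • ((N.H l l)ᴴ * (N.totalCov S l)⁻¹ * N.H l l) + Θ l =
      N.revOmega (N.dualCov S ν) l) (hΘ : ∀ l, (Θ l).PosSemidef) (hΘS : ∀ l, Θ l * S l = 0)
    (hconc : N.WeightedSumRateConcave ν) {T : N.Cov} (hT : ∀ l, (T l).PosSemidef) :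
    ∑ l, ν l * N.rate T l - ∑ l, ν l * N.rate S l ≤ N.power T - N.power S := by
  set φ : N.Cov → ℝ := fun S => ∑ l, ν l * N.rate S l with hφ
  set X : N.Cov := T + (-1 : ℝ) • S with hX
  have hd : HasDerivWithinAt (fun s : ℝ => φ (S + s • X)) (∑ l, ν l * N.rateDeriv S X l)
      (Set.Ici 0) 0 :=
    HasDerivWithinAt.fun_sum fun l _ => (hasDerivWithinAt_rate hS
      (hasDerivWithinAt_line S X _ _) (by rw [zero_smul, add_zero]) l).const_mul (ν l)
  have hg := (hd.sub_const (φ S)).sub ((hasDerivWithinAt_id 0 (Set.Ici (0 : ℝ))).mul_const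
    (φ T - φ S))
  have h1 := hg.nonneg_of_nonneg_right (by simp) (by
    filter_upwards [Icc_mem_nhdsGE (zero_lt_one (α := ℝ))] with s hs
    have h2 := hconc.2 hS hT (sub_nonneg.2 hs.2) hs.1 (by ring)
    have h3 : S + s • X = (1 - s) • S + s • T := by
      rw [hX]; module
    simp only [smul_eq_mul] at h2
    simp only [Pi.sub_apply, id]
    rw [h3]
    linarith)
  rw [sum_rateDeriv_of_isPriced h] at h1
  have h4 : ∑ l, (X l * Θ l).trace.re = ∑ l, (T l * Θ l).trace.re := by
    rw [← sub_zero (∑ l, (T l * Θ l).trace.re), ← sum_trace_mul_eq_zero hΘS,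
      ← Finset.sum_sub_distrib]
    refine Finset.sum_congr rfl fun l _ => ?_
    simp [hX, Matrix.add_mul, trace_add, sub_eq_add_neg]
  rw [h4, hX, power_add, power_smul] at h1
  have h5 := sum_trace_mul_nonneg hT hΘ
  linarith

end BMAC

/-! ### Consequences of the optimality conditions -/

namespace BMAC

open Matrix

variable {L : ℕ} {N : BMAC L} {S : N.Cov} {ν : Fin L → ℝ} {I₀ : Fin L → ℝ} {P : ℝ}

theorem lagrSPMP_le_power (hν : ∀ l, 0 ≤ ν l) {Θ T : N.Cov} (hΘ : ∀ l, (Θ l).PosSemidef)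
    (hT : T ∈ N.feasSPMP I₀) : N.lagrSPMP I₀ ν Θ T ≤ N.power T := by
  have h1 : 0 ≤ ∑ l, ν l * (N.rate T l - I₀ l) :=
    Finset.sum_nonneg fun l _ => mul_nonneg (hν l) (sub_nonneg.2 (hT.1 l))
  have h2 := sum_trace_mul_nonneg hT.2 hΘ
  unfold lagrSPMP
  linarith

theorem objFOPa_le_lagr [NeZero L] {lam : Fin L → ℝ} {μ : ℝ} (hlam : ∀ l, l ≠ 0 → 0 ≤ lam l)
    (hμ : 0 ≤ μ) {Θ T : N.Cov} (hΘ : ∀ l, (Θ l).PosSemidef) (hT : T ∈ N.feasFOPa I₀ P) :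
    N.objFOPa I₀ T ≤ N.lagrFOPa I₀ P lam μ Θ T := by
  have h1 : 0 ≤ ∑ l ∈ Finset.univ.erase 0, lam l * (N.rate T l / I₀ l - N.rate T 0 / I₀ 0) :=
    Finset.sum_nonneg fun l hl => mul_nonneg (hlam l (Finset.ne_of_mem_erase hl))
      (sub_nonneg.2 (hT.1 l (Finset.ne_of_mem_erase hl)))
  have h2 := sum_trace_mul_nonneg hT.2.1 hΘ
  have h3 := mul_nonneg hμ (sub_nonneg.2 hT.2.2)
  unfold lagrFOPa objFOPa
  linarith

theorem OptCondSPMP.kkt {S' : N.RevCov} (h : N.OptCondSPMP I₀ S S' ν) :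
    N.KKTSPMP I₀ S ∧ N.IsStationaryMax (fun T => -N.power T) (N.feasSPMP I₀) S := by
  obtain ⟨hpwf, hr⟩ := h
  have hS := hpwf.1.posSemidef
  have hν := fun l => (hpwf.2 l).1
  choose Θ hΘ hΘS hstat using hpwf.isPriced
  have hfeas : S ∈ N.feasSPMP I₀ := ⟨fun l => (hr l).ge, hS⟩
  have hval : N.lagrSPMP I₀ ν Θ S = N.power S := by
    simp [lagrSPMP, hr, sum_trace_mul_eq_zero hΘS]
  refine ⟨⟨hfeas, ν, Θ, hν, hΘ, fun l => by rw [hr, sub_self, mul_zero],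
    fun l => by rw [Matrix.trace_mul_comm, hΘS, trace_zero], fun X _ => ?_⟩,
    hfeas, fun c v d hc0 hcA hcv hd => ?_⟩
  · rw [← hasDerivWithinAt_univ]
    exact hasDerivWithinAt_lagrSPMP hS hstat I₀ (hasDerivWithinAt_line S X _ _)
      (by rw [zero_smul, add_zero])
  · have h1 := hasDerivWithinAt_lagrSPMP hS hstat I₀ (hasDerivWithinAt_apply hcv) hc0
    have h2 := (h1.neg.sub hd).nonneg_of_nonneg_right (by simp [hc0, hval]) (by
      filter_upwards [hcA] with s hs
      have := lagrSPMP_le_power hν hΘ hs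
      simp only [Pi.sub_apply, Pi.neg_apply]
      linarith)
    linarith

theorem OptCondSPMP.isOpt {S' : N.RevCov} (h : N.OptCondSPMP I₀ S S' ν)
    (hconc : N.WeightedSumRateConcave ν) : N.IsOptSPMP I₀ S := by
  obtain ⟨hpwf, hr⟩ := h
  have hS := hpwf.1.posSemidef
  choose Θ hΘ hΘS hstat using hpwf.isPriced
  refine ⟨⟨fun l => (hr l).ge, hS⟩, fun T hT => ?_⟩
  have h1 := sum_rate_sub_le_of_concave hS hstat hΘ hΘS hconc hT.2
  have h2 : ∑ l, ν l * N.rate S l ≤ ∑ l, ν l * N.rate T l :=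
    Finset.sum_le_sum fun l _ =>
      mul_le_mul_of_nonneg_left ((hr l).trans_le (hT.1 l)) (hpwf.2 l).1
  simp only [Set.mem_ofPred_eq]
  linarith

theorem sum_mul_pos [NeZero L] (hI : ∀ l, 0 < I₀ l) (hν : ∀ l, 0 < ν l) :
    0 < ∑ l, ν l * I₀ l :=
  Finset.sum_pos (fun l _ => mul_pos (hν l) (hI l)) ⟨0, Finset.mem_univ _⟩

theorem OptCondFOPa.pos (hI : ∀ l, 0 < I₀ l) {S' : N.RevCov}
    (h : N.OptCondFOPa I₀ P S S' ν) (l : Fin L) : 0 < ν l := by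
  obtain ⟨hpwf, ⟨α, hα, hr⟩, -⟩ := h
  refine pos_of_isPriced hpwf.1.posSemidef (fun l => (hpwf.2 l).1) hpwf.isPriced l ?_
  rw [hr]
  exact (mul_pos hα (hI l)).ne'

theorem OptCondFOPa.kkt [NeZero L] (hI : ∀ l, 0 < I₀ l) {S' : N.RevCov}
    (h : N.OptCondFOPa I₀ P S S' ν) :
    N.KKTFOPa I₀ P S ∧ N.IsStationaryMax (N.objFOPa I₀) (N.feasFOPa I₀ P) S := by
  have hν := h.pos hI
  obtain ⟨hpwf, ⟨α, hα, hr⟩, hP⟩ := h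
  have hS := hpwf.1.posSemidef
  choose Θ hΘ hΘS hstat using hpwf.isPriced
  have hκ := sum_mul_pos hI hν
  obtain ⟨κ, hκν⟩ : ∃ κ, κ = ∑ l, ν l * I₀ l := ⟨_, rfl⟩
  rw [← hκν] at hκ
  have hra : ∀ l, N.rate S l / I₀ l = α := fun l => by
    rw [hr, mul_div_assoc, div_self (hI l).ne', mul_one]
  have hfeas : S ∈ N.feasFOPa I₀ P := ⟨fun l _ => by rw [hra, hra], hS, hP.le⟩
  have hΘS' : ∀ l, (κ⁻¹ • Θ) l * S l = 0 := fun l => by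
    rw [Pi.smul_apply, Matrix.smul_mul, hΘS, smul_zero]
  have hΘ' : ∀ l, ((κ⁻¹ • Θ) l).PosSemidef := fun l => (hΘ l).smul (inv_pos.2 hκ).le
  have hval : N.lagrFOPa I₀ P (fun l => ν l * I₀ l / κ) κ⁻¹ (κ⁻¹ • Θ) S = N.objFOPa I₀ S := by
    simp only [lagrFOPa, objFOPa, hra, hP, sum_trace_mul_eq_zero hΘS']
    simp
  have hlam : ∀ l, l ≠ 0 → 0 ≤ ν l * I₀ l / κ := fun l _ =>
    div_nonneg (mul_pos (hν l) (hI l)).le hκ.le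
  refine ⟨⟨hfeas, _, κ⁻¹, κ⁻¹ • Θ, hlam, (inv_pos.2 hκ).le, hΘ',
    fun l _ => by rw [hra, hra, sub_self, mul_zero], by rw [hP, sub_self, mul_zero],
    fun l => by rw [Matrix.trace_mul_comm, hΘS', trace_zero], fun X _ => ?_⟩,
    hfeas, fun c v d hc0 hcA hcv hd => ?_⟩
  · rw [← hasDerivWithinAt_univ]
    exact hasDerivWithinAt_lagrFOPa hS hstat hI P hκ hκν (hasDerivWithinAt_line S X _ _)
      (by rw [zero_smul, add_zero])
  · have h1 := hasDerivWithinAt_lagrFOPa hS hstat hI P hκ hκν (hasDerivWithinAt_apply hcv) hc0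
    have h2 := (h1.sub hd).nonneg_of_nonneg_right (by simp [hc0, hval]) (by
      filter_upwards [hcA] with s hs
      have := objFOPa_le_lagr hlam (inv_pos.2 hκ).le hΘ' hs
      simp only [Pi.sub_apply]
      linarith)
    linarith

theorem OptCondFOPa.isOpt [NeZero L] (hI : ∀ l, 0 < I₀ l) {S' : N.RevCov}
    (h : N.OptCondFOPa I₀ P S S' ν) (hconc : N.WeightedSumRateConcave ν) :
    N.IsOptFOPa I₀ P S := by
  have hfeas := (h.kkt hI).1.1
  have hν := h.pos hI
  obtain ⟨hpwf, ⟨α, hα, hr⟩, hP⟩ := h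
  have hS := hpwf.1.posSemidef
  choose Θ hΘ hΘS hstat using hpwf.isPriced
  refine ⟨hfeas, fun T hT => ?_⟩
  have h1 := sum_rate_sub_le_of_concave hS hstat hΘ hΘS hconc hT.2.1
  have h2 : N.rate T 0 / I₀ 0 * ∑ l, ν l * I₀ l ≤ ∑ l, ν l * N.rate T l := by
    rw [Finset.mul_sum]
    refine Finset.sum_le_sum fun l _ => ?_
    have h3 : N.rate T 0 / I₀ 0 ≤ N.rate T l / I₀ l := by
      by_cases hl : l = 0
      · rw [hl]
      · exact hT.1 l hl
    rw [le_div_iff₀ (hI l)] at h3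
    nlinarith [hν l]
  have h4 : ∑ l, ν l * N.rate S l = α * ∑ l, ν l * I₀ l := by
    rw [Finset.mul_sum]
    exact Finset.sum_congr rfl fun l _ => by rw [hr]; ring
  have h5 : N.objFOPa I₀ S = α := by
    rw [objFOPa, hr, mul_div_assoc, div_self (hI 0).ne', mul_one]
  have hTP := hT.2.2
  simp only [Set.mem_ofPred_eq]
  rw [h5, objFOPa]
  refine le_of_mul_le_mul_right ?_ (sum_mul_pos hI hν)
  linarith

end BMAC

/-! ### First-order necessary conditions -/

/-- Theorem of the alternative for finitely many affine functions on a convex set: if they are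
nowhere simultaneously positive, then some nontrivial nonnegative combination is nonpositive. -/
theorem exists_nonneg_multipliers {E J : Type*} [AddCommGroup E] [Module ℝ E] [Fintype J]
    {C : Set E} (hC : Convex ℝ C) (hne : C.Nonempty) {a : J → E → ℝ}
    (ha : ∀ j, ∀ x y : E, ∀ s t : ℝ, s + t = 1 → a j (s • x + t • y) = s * a j x + t * a j y)
    (h : ∀ x ∈ C, ∃ j, a j x ≤ 0) :
    ∃ w : J → ℝ, (∀ j, 0 ≤ w j) ∧ w ≠ 0 ∧ ∀ x ∈ C, ∑ j, w j * a j x ≤ 0 := by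
  classical
  have hO : IsOpen {z : J → ℝ | ∀ j, 0 < z j} := by
    simp only [Set.ofPred_forall]
    exact isOpen_iInter_of_finite fun j => isOpen_lt continuous_const (continuous_apply j)
  have hOc : Convex ℝ {z : J → ℝ | ∀ j, 0 < z j} := by
    intro x hx y hy s t hs ht hst j
    simp only [Pi.add_apply, Pi.smul_apply, smul_eq_mul]
    have h1 := hx j
    have h2 := hy j
    rcases hs.eq_or_lt with rfl | hs
    · rw [zero_add] at hst; subst hst; simpa using h2
    · have := mul_nonneg ht h2.le
      have := mul_pos hs h1
      linarith
  have hI : Convex ℝ ((fun x j => a j x) '' C) := by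
    rintro _ ⟨x, hx, rfl⟩ _ ⟨y, hy, rfl⟩ s t hs ht hst
    exact ⟨_, hC hx hy hs ht hst, funext fun j => by simp [ha j x y s t hst]⟩
  obtain ⟨f, u, hf1, hf2⟩ := geometric_hahn_banach_open hOc hO hI
    (Set.disjoint_left.2 fun z hz ⟨x, hx, hxz⟩ => by
      obtain ⟨j, hj⟩ := h x hx
      have := hz j
      rw [← hxz] at this
      exact absurd hj (not_le.2 this))
  have h1 : ∀ z : J → ℝ, (∀ j, 0 < z j) → f z ≤ 0 := by
    intro z hz
    by_contra hcon
    push Not at hcon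
    have h3 := hf1 ((|u| / f z + 1) • z) fun j => by
      have := hz j
      simp only [Pi.smul_apply, smul_eq_mul]
      positivity
    rw [map_smul, smul_eq_mul, add_mul, div_mul_cancel₀ _ hcon.ne'] at h3
    have := le_abs_self u
    linarith
  have h2 : 0 ≤ u := by
    have h3 : Filter.Tendsto (fun ε : ℝ => ε * f 1) (𝓝[>] 0) (𝓝 (0 * f 1)) :=
      ((continuous_id.mul continuous_const).tendsto 0).mono_left nhdsWithin_le_nhds
    rw [zero_mul] at h3
    refine le_of_tendsto h3 ?_
    filter_upwards [self_mem_nhdsWithin] with ε hε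
    have := hf1 (ε • 1) fun j => by simpa using hε
    rw [map_smul, smul_eq_mul] at this
    exact this.le
  have hsum : ∀ z : J → ℝ, f z = ∑ j, f (Pi.single j 1) * z j := by
    intro z
    conv_lhs => rw [pi_eq_sum_univ' z, map_sum]
    refine Finset.sum_congr rfl fun j _ => ?_
    rw [map_smul, smul_eq_mul, mul_comm]
  refine ⟨fun j => -f (Pi.single j 1), fun j => ?_, fun h0 => ?_, fun x hx => ?_⟩
  · have h3 : Filter.Tendsto (fun ε : ℝ => f (Pi.single j 1) + ε * f 1) (𝓝[>] 0)
        (𝓝 (f (Pi.single j 1) + 0 * f 1)) :=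
      ((continuous_const.add (continuous_id.mul continuous_const)).tendsto 0).mono_left
        nhdsWithin_le_nhds
    rw [zero_mul, add_zero] at h3
    rw [neg_nonneg]
    refine le_of_tendsto h3 ?_
    filter_upwards [self_mem_nhdsWithin] with ε hε
    have := h1 (Pi.single j 1 + ε • 1) fun i => by
      have hε' : 0 < ε := hε
      have : (0 : ℝ) ≤ (Pi.single j 1 : J → ℝ) i := by
        by_cases hi : i = j
        · subst hi; simp
        · simp [hi]
      simp only [Pi.add_apply, Pi.smul_apply, Pi.one_apply, smul_eq_mul, mul_one]
      linarith
    rwa [map_add, map_smul, smul_eq_mul] at this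
  · have hf0 : ∀ z, f z = 0 := fun z => by
      rw [hsum]
      exact Finset.sum_eq_zero fun j _ => by
        have := congrFun h0 j
        simp only [Pi.zero_apply, neg_eq_zero] at this
        rw [this, zero_mul]
    obtain ⟨x, hx⟩ := hne
    have h3 := hf2 _ ⟨x, hx, rfl⟩
    have h4 := hf1 1 fun j => zero_lt_one
    rw [hf0] at h3 h4
    linarith
  · have h3 := hf2 _ ⟨x, hx, rfl⟩
    rw [hsum] at h3
    simp only [neg_mul, Finset.sum_neg_distrib]
    linarith

/-- A constraint function that is nonnegative at the start becomes positive along the curve, if it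
is inactive or has a positive derivative. The hypothesis `0 < d + g 0` suffices for this. -/
theorem HasDerivWithinAt.eventually_pos_right {g : ℝ → ℝ} {d : ℝ}
    (hg : HasDerivWithinAt g d (Set.Ici 0) 0) (h0 : 0 ≤ g 0) (h : 0 < d + g 0) :
    ∀ᶠ s in 𝓝[>] (0 : ℝ), 0 < g s := by
  rcases h0.eq_or_lt with h0 | h0
  · rw [← h0, add_zero] at h
    have h1 := (hasDerivWithinAt_iff_tendsto_slope' Set.self_notMem_Ioi).1 hg.Ioi_of_Ici
    filter_upwards [h1.eventually_const_lt h, self_mem_nhdsWithin] with s hs hs0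
    rw [slope_def_field, ← h0, sub_zero, sub_zero] at hs
    have hs0' : 0 < s := hs0
    rwa [div_pos_iff_of_pos_right hs0'] at hs
  · have h1 : ContinuousWithinAt g (Set.Ioi 0) 0 :=
      hg.continuousWithinAt.mono Set.Ioi_subset_Ici_self
    exact h1.eventually_const_lt h0

/-! ### Optima are stationary -/

namespace BMAC

open Matrix

variable {L : ℕ} {N : BMAC L} {S : N.Cov} {I₀ : Fin L → ℝ} {P : ℝ}

theorem dualCov_isHermitian (hS : ∀ l, (S l).PosSemidef) (y : Fin L → ℝ) (l : Fin L) :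
    (N.dualCov S y l)ᴴ = N.dualCov S y l := by
  rw [dualCov, conjTranspose_smul, conjTranspose_sub, (Omega_posDef hS l).inv.isHermitian.eq,
    (totalCov_posDef hS l).inv.isHermitian.eq, star_trivial]

theorem single_posSemidef (l : Fin L) {Y : Matrix (Fin (N.nT l)) (Fin (N.nT l)) ℂ}
    (hY : Y.PosSemidef) (k : Fin L) : ((Pi.single l Y : N.Cov) k).PosSemidef := by
  by_cases h : k = l
  · subst h; rwa [Pi.single_eq_same]
  · rw [Pi.single_eq_of_ne h]; exact PosSemidef.zero

/-- First-order conditions over the cone of tuples of positive semidefinite matrices, for a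
linear functional that is a combination of the rates and the sum power: they yield the
multipliers of `Σ_l ⪰ 0`, and `σ = 0` is complementary slackness for the scalar constraints. -/
theorem exists_multipliers_of_le (hS : ∀ l, (S l).PosSemidef) {y : Fin L → ℝ} {μ σ : ℝ}
    (hσ : 0 ≤ σ) (h : ∀ X : N.Cov, (∀ l, (S l + X l).PosSemidef) →
      ∑ l, y l * N.rateDeriv S X l - μ * N.power X + σ ≤ 0) :
    σ = 0 ∧ ∃ Θ : N.Cov, (∀ l, (Θ l).PosSemidef) ∧ (∀ l, Θ l * S l = 0) ∧
      ∀ l, y l • ((N.H l l)ᴴ * (N.totalCov S l)⁻¹ * N.H l l) + Θ l =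
        N.revOmega (N.dualCov S y) l + (μ - 1) • 1 := by
  set Θ : N.Cov := fun l => N.revOmega (N.dualCov S y) l + (μ - 1) • 1 -
    y l • ((N.H l l)ᴴ * (N.totalCov S l)⁻¹ * N.H l l) with hΘ
  have hf : ∀ X : N.Cov, ∑ l, y l * N.rateDeriv S X l - μ * N.power X =
      -∑ l, (Θ l * X l).trace.re := by
    intro X
    rw [sum_rateDeriv, power, Finset.mul_sum, ← Finset.sum_sub_distrib, ← Finset.sum_neg_distrib]
    refine Finset.sum_congr rfl fun l _ => ?_
    simp only [hΘ, sub_smul, one_smul, Matrix.sub_mul, Matrix.add_mul, Matrix.one_mul,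
      Matrix.smul_mul, trace_sub, trace_add, trace_smul, Complex.sub_re, Complex.add_re,
      Complex.smul_re, smul_eq_mul]
    ring
  simp only [hf] at h
  have h0 : σ = 0 := by
    have := h 0 (by simpa using hS)
    simp at this
    exact le_antisymm this hσ
  subst h0
  simp only [add_zero, neg_nonpos] at h
  have hherm : ∀ l, (Θ l).IsHermitian := by
    intro l
    have h1 : (N.revOmega (N.dualCov S y) l)ᴴ = N.revOmega (N.dualCov S y) l := by
      simp [revOmega, conjTranspose_sum, conjTranspose_mul, dualCov_isHermitian hS,
        Matrix.mul_assoc]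
    have h2 : ((N.H l l)ᴴ * (N.totalCov S l)⁻¹ * N.H l l)ᴴ =
        (N.H l l)ᴴ * (N.totalCov S l)⁻¹ * N.H l l := by
      rw [conjTranspose_mul, conjTranspose_mul, (totalCov_posDef hS l).inv.isHermitian.eq,
        conjTranspose_conjTranspose, Matrix.mul_assoc]
    simp only [hΘ, IsHermitian, conjTranspose_sub, conjTranspose_add, conjTranspose_smul, h1, h2,
      star_trivial, conjTranspose_one]
  have hpsd : ∀ l, (Θ l).PosSemidef := by
    intro l
    refine PosSemidef.of_dotProduct_mulVec_nonneg (hherm l) fun x => ?_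
    have h1 := h (Pi.single l (vecMulVec x (star x))) fun k =>
      (hS k).add (single_posSemidef l (posSemidef_vecMulVec_self_star x) k)
    rw [Finset.sum_eq_single l (fun k _ hk => by rw [Pi.single_eq_of_ne hk]; simp) (by simp),
      Pi.single_eq_same, mul_vecMulVec, trace_vecMulVec, dotProduct_comm] at h1
    rw [Complex.nonneg_iff]
    exact ⟨h1, ((hherm l).im_star_dotProduct_mulVec_self x).symm⟩
  refine ⟨rfl, Θ, hpsd, fun l => ?_, fun l => by simp only [hΘ]; abel⟩
  have h1 := h (-S) fun l => by
    rw [Pi.neg_apply, add_neg_cancel]; exact PosSemidef.zero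
  simp only [Pi.neg_apply, Matrix.mul_neg, trace_neg, Complex.neg_re, Finset.sum_neg_distrib,
    Left.nonneg_neg_iff] at h1
  have h2 : ∀ k ∈ Finset.univ, 0 ≤ (Θ k * S k).trace.re := fun k _ =>
    (Complex.nonneg_iff.1 ((hpsd k).trace_mul_nonneg (hS k))).1
  have h3 := (Finset.sum_eq_zero_iff_of_nonneg h2).1 (le_antisymm h1 (Finset.sum_nonneg h2)) l
    (Finset.mem_univ l)
  refine (hpsd l).mul_eq_zero_of_trace (hS l) (Complex.ext h3 ?_)
  exact (Complex.nonneg_iff.1 ((hpsd l).trace_mul_nonneg (hS l))).2.symm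

/-- If scaling up the covariances improves every rate, a nontrivial first-order condition has a
positive power multiplier; after normalization it is the stationarity condition for the dual
covariances. -/
theorem isPriced_of_le (hS : ∀ l, (S l).PosSemidef) (hr : ∀ l, N.rate S l ≠ 0)
    {y : Fin L → ℝ} (hy : ∀ l, 0 ≤ y l) {μ σ : ℝ} (hμ : 0 ≤ μ) (hne : μ = 0 → y ≠ 0)
    (hσ : 0 ≤ σ) (h : ∀ X : N.Cov, (∀ l, (S l + X l).PosSemidef) →
      ∑ l, y l * N.rateDeriv S X l - μ * N.power X + σ ≤ 0) :
    0 < μ ∧ (∀ l, 0 < y l) ∧ σ = 0 ∧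
      N.IsPriced S (fun l => y l / μ) (N.revOmega (N.dualCov S (fun l => y l / μ))) := by
  have hμpos : 0 < μ := by
    refine lt_of_le_of_ne hμ fun h0 => hne h0.symm ?_
    have h1 := h S fun l => (hS l).add (hS l)
    rw [← h0, zero_mul, sub_zero] at h1
    have h2 : ∀ l ∈ Finset.univ, 0 ≤ y l * N.rateDeriv S S l := fun l _ =>
      mul_nonneg (hy l) (rateDeriv_self_pos hS l (hr l)).le
    have h3 := (Finset.sum_eq_zero_iff_of_nonneg h2).1
      (le_antisymm (by linarith) (Finset.sum_nonneg h2))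
    funext l
    exact (mul_eq_zero.1 (h3 l (Finset.mem_univ l))).resolve_right
      (rateDeriv_self_pos hS l (hr l)).ne'
  obtain ⟨hσ0, Θ, hΘ, hΘS, hΘeq⟩ := exists_multipliers_of_le (y := fun l => y l / μ) (μ := 1)
    (σ := σ / μ) hS (by positivity) fun X hX => by
      have h1 := h X hX
      have h2 : ∑ l, y l / μ * N.rateDeriv S X l - 1 * N.power X + σ / μ =
          (∑ l, y l * N.rateDeriv S X l - μ * N.power X + σ) / μ := by
        rw [add_div, sub_div, Finset.sum_div, mul_div_cancel_left₀ _ hμpos.ne', one_mul]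
        congr 2
        exact Finset.sum_congr rfl fun l _ => by ring
      rw [h2]
      exact div_nonpos_of_nonpos_of_nonneg h1 hμ
  have hpr : N.IsPriced S (fun l => y l / μ) (N.revOmega (N.dualCov S (fun l => y l / μ))) :=
    fun l => ⟨Θ l, hΘ l, hΘS l, by rw [hΘeq l, sub_self, zero_smul, add_zero]⟩
  refine ⟨hμpos, fun l => ?_, (div_eq_zero_iff.1 hσ0).resolve_right hμpos.ne', hpr⟩
  have := pos_of_isPriced hS (fun l => div_nonneg (hy l) hμ) hpr l (hr l)
  rwa [div_pos_iff_of_pos_right hμpos] at this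

theorem convex_posSemidef : Convex ℝ {T : N.Cov | ∀ l, (T l).PosSemidef} :=
  fun _ hx _ hy _ _ hs ht _ l => ((hx l).smul hs).add ((hy l).smul ht)

theorem eventually_add_smul_posSemidef (hS : ∀ l, (S l).PosSemidef) {T : N.Cov}
    (hT : ∀ l, (T l).PosSemidef) :
    ∀ᶠ s in 𝓝[>] (0 : ℝ), ∀ l, ((S + s • (T + (-1 : ℝ) • S)) l).PosSemidef := by
  filter_upwards [Ioc_mem_nhdsGT (zero_lt_one (α := ℝ))] with s hs
  have h3 : S + s • (T + (-1 : ℝ) • S) = (1 - s) • S + s • T := by module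
  rw [h3]
  exact convex_posSemidef hS hT (sub_nonneg.2 hs.2) hs.1.le (by ring)

theorem rateDeriv_add_smul_neg {x y S : N.Cov} {s t : ℝ} (hst : s + t = 1) (l : Fin L) :
    N.rateDeriv S (s • x + t • y + (-1 : ℝ) • S) l =
      s * N.rateDeriv S (x + (-1 : ℝ) • S) l + t * N.rateDeriv S (y + (-1 : ℝ) • S) l := by
  simp only [rateDeriv_add, rateDeriv_smul]
  linear_combination (N.rateDeriv S S l) * hst

theorem power_add_smul_neg {x y S : N.Cov} {s t : ℝ} (hst : s + t = 1) :
    N.power (s • x + t • y + (-1 : ℝ) • S) =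
      s * N.power (x + (-1 : ℝ) • S) + t * N.power (y + (-1 : ℝ) • S) := by
  simp only [power_add, power_smul]
  linear_combination (N.power S) * hst

theorem hasDerivWithinAt_rate_line (hS : ∀ l, (S l).PosSemidef) (X : N.Cov) (s : Set ℝ)
    (l : Fin L) :
    HasDerivWithinAt (fun t : ℝ => N.rate (S + t • X) l) (N.rateDeriv S X l) s 0 :=
  hasDerivWithinAt_rate hS (hasDerivWithinAt_line S X _ _) (by rw [zero_smul, add_zero]) l

theorem hasDerivWithinAt_power_line (S X : N.Cov) (s : Set ℝ) :
    HasDerivWithinAt (fun t : ℝ => N.power (S + t • X)) (N.power X) s 0 :=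
  hasDerivWithinAt_power (hasDerivWithinAt_line S X _ _)

/-- An optimum of SPMP meets the target rates with equality and is stationary. The target rates can
be exceeded by scaling, which is the constraint qualification. -/
theorem IsOptSPMP.isPriced (hI : ∀ l, 0 < I₀ l) (h : N.IsOptSPMP I₀ S) :
    (∀ l, N.rate S l = I₀ l) ∧ ∃ ν : Fin L → ℝ, (∀ l, 0 ≤ ν l) ∧
      N.IsPriced S ν (N.revOmega (N.dualCov S ν)) := by
  obtain ⟨⟨hr, hS⟩, hmin⟩ := h
  have hr0 : ∀ l, N.rate S l ≠ 0 := fun l => ((hI l).trans_le (hr l)).ne'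
  obtain ⟨w, hw, hw0, hle⟩ := exists_nonneg_multipliers (J := Option (Fin L))
    (a := fun j T => j.elim (-N.power (T + (-1 : ℝ) • S))
      fun l => N.rateDeriv S (T + (-1 : ℝ) • S) l + (N.rate S l - I₀ l))
    (convex_posSemidef (N := N)) ⟨S, hS⟩ (by
      rintro (_ | l) x y s t hst
      · simp only [Option.elim]
        rw [power_add_smul_neg hst]; ring
      · simp only [Option.elim]
        rw [rateDeriv_add_smul_neg hst]
        linear_combination -(N.rate S l - I₀ l) * hst) (by
      intro T hT
      by_contra hcon
      push Not at hcon
      set X := T + (-1 : ℝ) • S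
      have h1 : ∀ᶠ s in 𝓝[>] (0 : ℝ), 0 < N.power S - N.power (S + s • X) :=
        ((hasDerivWithinAt_power_line S X _).const_sub _).eventually_pos_right (by simp) (by
          have := hcon none
          simp only [Option.elim] at this
          simpa using this)
      have h2 : ∀ᶠ s in 𝓝[>] (0 : ℝ), ∀ l, 0 < N.rate (S + s • X) l - I₀ l := by
        rw [Filter.eventually_all]
        intro l
        refine ((hasDerivWithinAt_rate_line hS X _ l).sub_const (I₀ l)).eventually_pos_right ?_ ?_
        · simpa using hr l
        · have := hcon (some l)
          simp only [Option.elim] at this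
          simpa using this
      obtain ⟨s, hs1, hs2, hs3⟩ :=
        (h1.and (h2.and (eventually_add_smul_posSemidef hS hT))).exists
      have h4 : N.power S ≤ N.power (S + s • X) := hmin ⟨fun l => by linarith [hs2 l], hs3⟩
      linarith)
  have hσ : 0 ≤ ∑ l, w (some l) * (N.rate S l - I₀ l) :=
    Finset.sum_nonneg fun l _ => mul_nonneg (hw _) (sub_nonneg.2 (hr l))
  obtain ⟨hμ, hy, hσ0, hpr⟩ := isPriced_of_le hS hr0 (y := fun l => w (some l)) (fun l => hw _)
    (hw none) (fun h0 h1 => hw0 (by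
      funext j
      rcases j with _ | l
      · exact h0
      · exact congrFun h1 l)) hσ (fun X hX => by
      have h1 := hle (S + X) hX
      rw [Fintype.sum_option] at h1
      have h2 : S + X + (-1 : ℝ) • S = X := by module
      simp only [Option.elim, h2, mul_add, Finset.sum_add_distrib] at h1
      linarith)
  refine ⟨fun l => ?_, _, fun l => (div_pos (hy l) hμ).le, hpr⟩
  have h1 := (Finset.sum_eq_zero_iff_of_nonneg fun l _ =>
    mul_nonneg (hw (some l)) (sub_nonneg.2 (hr l))).1 hσ0 l (Finset.mem_univ l)
  exact sub_eq_zero.1 ((mul_eq_zero.1 h1).resolve_left (hy l).ne')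

end BMAC

namespace BMAC

open Matrix

variable {L : ℕ} {N : BMAC L} {S : N.Cov} {I₀ : Fin L → ℝ} {P : ℝ}

/-- For a single stream the rate is `log (1 + SINR)`. -/
theorem rate_pos_of_vecMulVec (hS : ∀ l, (S l).PosSemidef) (l : Fin L) {t : Fin (N.nT l) → ℂ}
    {e : ℝ} (he : 0 < e) (ht : N.H l l *ᵥ t ≠ 0) (hSl : S l = e • vecMulVec t (star t)) :
    0 < N.rate S l := by
  have hO := Omega_posDef hS l
  have h1 := hO.inv.dotProduct_mulVec_pos ht
  have hdet : (1 + N.H l l * S l * (N.H l l)ᴴ * (N.Omega S l)⁻¹).det =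
      1 + (e : ℂ) * (star (N.H l l *ᵥ t) ⬝ᵥ ((N.Omega S l)⁻¹ *ᵥ (N.H l l *ᵥ t))) := by
    rw [hSl, Matrix.mul_smul, Matrix.smul_mul, Matrix.smul_mul, mul_vecMulVec_star_mul,
      vecMulVec_mul, ← smul_vecMulVec, vecMulVec_eq Unit, det_one_add_replicateCol_mul_replicateRow,
      dotProduct_smul, ← dotProduct_mulVec, Complex.real_smul]
  rw [rate, hdet]
  refine Real.log_pos ?_
  rw [Complex.add_re, Complex.one_re, Complex.re_ofReal_mul]
  have := mul_pos he (Complex.pos_iff.1 h1).1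
  linarith

/-- FOPa has a feasible point with a positive objective: give each link a single stream, and let
the power of the first link tend to zero. -/
theorem exists_feasFOPa_rate_pos [NeZero L] (hH : ∀ l, N.H l l ≠ 0) (hI : ∀ l, 0 < I₀ l)
    (hP : 0 < P) : ∃ T ∈ N.feasFOPa I₀ P, 0 < N.rate T 0 := by
  have hex : ∀ l, ∃ t : Fin (N.nT l) → ℂ, N.H l l *ᵥ t ≠ 0 := by
    intro l
    by_contra hcon
    push Not at hcon
    exact hH l (Matrix.ext_of_mulVec_single fun i => by rw [hcon, zero_mulVec])
  choose t ht using hex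
  set Z : N.Cov := fun l => vecMulVec (t l) (star (t l)) with hZ
  have hZp : ∀ l, (Z l).PosSemidef := fun l => posSemidef_vecMulVec_self_star _
  have hZ0 : 0 ≤ N.power Z :=
    Finset.sum_nonneg fun l _ => (Complex.nonneg_iff.1 (hZp l).trace_nonneg).1
  obtain ⟨e, he, heP⟩ : ∃ e : ℝ, 0 < e ∧ e * N.power Z ≤ P := by
    refine ⟨P / (N.power Z + 1), by positivity, ?_⟩
    rw [div_mul_eq_mul_div, div_le_iff₀ (by positivity)]
    nlinarith
  set B : N.Cov := Pi.single 0 (e • Z 0) with hB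
  set A : N.Cov := e • Z + (-1 : ℝ) • B with hA
  have hA0 : A 0 = 0 := by simp [hA, hB]
  have hAl : ∀ l, l ≠ 0 → A l = e • vecMulVec (t l) (star (t l)) := fun l hl => by
    simp [hA, hB, hl, hZ]
  have hAp : ∀ l, (A l).PosSemidef := by
    intro l
    by_cases hl : l = 0
    · subst hl; rw [hA0]; exact PosSemidef.zero
    · rw [hAl l hl]; exact (hZp l).smul he.le
  have hBp : ∀ l, (B l).PosSemidef := single_posSemidef 0 ((hZp 0).smul he.le)
  have hB0 : 0 ≤ N.power B :=
    Finset.sum_nonneg fun l _ => (Complex.nonneg_iff.1 (hBp l).trace_nonneg).1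
  have hlim : ∀ᶠ s in 𝓝[>] (0 : ℝ), ∀ l, l ≠ 0 →
      N.rate (A + s • B) 0 / I₀ 0 < N.rate (A + s • B) l / I₀ l := by
    rw [Filter.eventually_all]
    intro l
    by_cases hl : l = 0
    · exact .of_forall fun s h => absurd hl h
    have hc : ∀ k, ContinuousWithinAt (fun s : ℝ => N.rate (A + s • B) k / I₀ k)
        (Set.Ioi 0) 0 := fun k =>
      (hasDerivWithinAt_rate_line hAp B _ k).continuousWithinAt.div_const _
    have h0 : N.rate (A + (0 : ℝ) • B) 0 / I₀ 0 = 0 := by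
      rw [zero_smul, add_zero, rate, hA0]; simp
    have h1 : 0 < N.rate (A + (0 : ℝ) • B) l / I₀ l := by
      rw [zero_smul, add_zero]
      exact div_pos (rate_pos_of_vecMulVec hAp l he (ht l) (hAl l hl)) (hI l)
    have h2 := (hc 0).eventually_lt (hc l) (h0.trans_lt h1)
    exact h2.mono fun s hs _ => hs
  obtain ⟨s, hs1, hs2⟩ := (hlim.and (Ioc_mem_nhdsGT (zero_lt_one (α := ℝ)))).exists
  have hTp : ∀ l, ((A + s • B) l).PosSemidef := fun l => (hAp l).add ((hBp l).smul hs2.1.le)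
  refine ⟨A + s • B, ⟨fun l hl => (hs1 l hl).le, hTp, ?_⟩, ?_⟩
  · rw [power_add, power_smul, hA, power_add, power_smul, power_smul]
    nlinarith [hs2.2]
  · refine rate_pos_of_vecMulVec hTp 0 (mul_pos hs2.1 he) (ht 0) ?_
    simp [hA0, hB, hZ, mul_smul]

/-- The multiplier of the first rate is nonnegative: otherwise switching off the first link, which
helps all other links and saves power, would violate the first-order condition. -/
theorem nonneg_of_le_switch_off [NeZero L] (hS : ∀ l, (S l).PosSemidef) (hr : N.rate S 0 ≠ 0)
    {y : Fin L → ℝ} (hy : ∀ l, l ≠ 0 → 0 ≤ y l) {μ σ : ℝ} (hμ : 0 ≤ μ) (hσ : 0 ≤ σ)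
    (h : ∀ X : N.Cov, (∀ l, (S l + X l).PosSemidef) →
      ∑ l, y l * N.rateDeriv S X l - μ * N.power X + σ ≤ 0) : 0 ≤ y 0 := by
  have hpsd : ∀ l k, (N.Φ l k • ((N.H l k)ᴴ * ((N.Omega S l)⁻¹ - (N.totalCov S l)⁻¹) *
      N.H l k)).PosSemidef := fun l k =>
    ((posSemidef_inv_sub_inv_add (Omega_posDef hS l)
      ((hS l).mul_mul_conjTranspose_same _)).conjTranspose_mul_mul_same _).smul (N.Φ_nonneg l k)
  have hpos : 0 < ((N.H 0 0)ᴴ * (N.totalCov S 0)⁻¹ * N.H 0 0 * S 0).trace.re := by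
    have h1 := rateDeriv_self_pos hS 0 hr
    rw [rateDeriv_eq] at h1
    have h2 : 0 ≤ ∑ k, (N.Φ 0 k • ((N.H 0 k)ᴴ * ((N.Omega S 0)⁻¹ - (N.totalCov S 0)⁻¹) *
        N.H 0 k) * S k).trace.re :=
      Finset.sum_nonneg fun k _ =>
        (Complex.nonneg_iff.1 ((hpsd 0 k).trace_mul_nonneg (hS k))).1
    linarith
  have hX := h (Pi.single 0 (-S 0)) fun l => by
    by_cases hl : l = 0
    · subst hl; rw [Pi.single_eq_same, add_neg_cancel]; exact PosSemidef.zero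
    · rw [Pi.single_eq_of_ne hl, add_zero]; exact hS l
  have hd : ∀ l, N.rateDeriv S (Pi.single 0 (-S 0)) l =
      ((N.H l l)ᴴ * (N.totalCov S l)⁻¹ * N.H l l * (Pi.single 0 (-S 0) : N.Cov) l).trace.re +
      (N.Φ l 0 • ((N.H l 0)ᴴ * ((N.Omega S l)⁻¹ - (N.totalCov S l)⁻¹) * N.H l 0) *
        S 0).trace.re := by
    intro l
    rw [rateDeriv_eq, Finset.sum_eq_single 0 (fun k _ hk => by rw [Pi.single_eq_of_ne hk]; simp)
      (by simp), Pi.single_eq_same, Matrix.mul_neg, trace_neg, Complex.neg_re, sub_neg_eq_add]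
  have hpow : N.power (Pi.single 0 (-S 0)) ≤ 0 := by
    rw [power, Finset.sum_eq_single 0 (fun k _ hk => by rw [Pi.single_eq_of_ne hk]; simp)
      (by simp), Pi.single_eq_same, trace_neg, Complex.neg_re, neg_nonpos]
    exact (Complex.nonneg_iff.1 (hS 0).trace_nonneg).1
  have h0 : N.rateDeriv S (Pi.single 0 (-S 0)) 0 < 0 := by
    rw [hd, Pi.single_eq_same, N.Φ_diag, Matrix.mul_neg, trace_neg, Complex.neg_re, zero_smul,
      Matrix.zero_mul, trace_zero, Complex.zero_re]
    linarith
  have hrest : 0 ≤ ∑ l ∈ Finset.univ.erase 0, y l * N.rateDeriv S (Pi.single 0 (-S 0)) l := by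
    refine Finset.sum_nonneg fun l hl => mul_nonneg (hy l (Finset.ne_of_mem_erase hl)) ?_
    rw [hd, Pi.single_eq_of_ne (Finset.ne_of_mem_erase hl), Matrix.mul_zero, trace_zero,
      Complex.zero_re, zero_add]
    exact (Complex.nonneg_iff.1 ((hpsd l 0).trace_mul_nonneg (hS 0))).1
  rw [← Finset.add_sum_erase _ _ (Finset.mem_univ 0)] at hX
  by_contra hcon
  push Not at hcon
  have := mul_pos_of_neg_of_neg hcon h0
  have := mul_nonpos_of_nonneg_of_nonpos hμ hpow
  linarith

/-- An optimum of FOPa has proportional rates and full power, and is stationary. -/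
theorem IsOptFOPa.isPriced [NeZero L] (hH : ∀ l, N.H l l ≠ 0) (hI : ∀ l, 0 < I₀ l) (hP : 0 < P)
    (h : N.IsOptFOPa I₀ P S) :
    (∃ α : ℝ, 0 < α ∧ ∀ l, N.rate S l = α * I₀ l) ∧ N.power S = P ∧
      ∃ ν : Fin L → ℝ, (∀ l, 0 ≤ ν l) ∧ N.IsPriced S ν (N.revOmega (N.dualCov S ν)) := by
  obtain ⟨⟨hr, hS, hSP⟩, hmax⟩ := h
  obtain ⟨T₀, hT₀, hT₀r⟩ := exists_feasFOPa_rate_pos hH hI hP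
  have hα : 0 < N.rate S 0 / I₀ 0 := (div_pos hT₀r (hI 0)).trans_le (hmax hT₀)
  have hra : ∀ l, 0 < N.rate S l / I₀ l := fun l => by
    by_cases hl : l = 0
    · rwa [hl]
    · exact hα.trans_le (hr l hl)
  have hr0 : ∀ l, N.rate S l ≠ 0 := fun l => ((div_pos_iff_of_pos_right (hI l)).1 (hra l)).ne'
  -- one affine function for each constraint, and one for the objective at the index of link `0`
  obtain ⟨w, hw, hw0, hle⟩ := exists_nonneg_multipliers (J := Option (Fin L))
    (a := fun j T => j.elim (-N.power (T + (-1 : ℝ) • S) + (P - N.power S))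
      fun l => if l = 0 then N.rateDeriv S (T + (-1 : ℝ) • S) 0 / I₀ 0 else
        N.rateDeriv S (T + (-1 : ℝ) • S) l / I₀ l - N.rateDeriv S (T + (-1 : ℝ) • S) 0 / I₀ 0 +
          (N.rate S l / I₀ l - N.rate S 0 / I₀ 0))
    (convex_posSemidef (N := N)) ⟨S, hS⟩ (by
      rintro (_ | l) x y s t hst
      · simp only [Option.elim]
        rw [power_add_smul_neg hst]
        linear_combination -(P - N.power S) * hst
      · simp only [Option.elim]
        rw [rateDeriv_add_smul_neg hst, rateDeriv_add_smul_neg hst]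
        split_ifs
        · ring
        · linear_combination -(N.rate S l / I₀ l - N.rate S 0 / I₀ 0) * hst) (by
      intro T hT
      by_contra hcon
      push Not at hcon
      set X := T + (-1 : ℝ) • S
      have hd := fun l => (hasDerivWithinAt_rate_line hS X (Set.Ici 0) l).div_const (I₀ l)
      have h1 : ∀ᶠ s in 𝓝[>] (0 : ℝ), 0 < P - N.power (S + s • X) :=
        ((hasDerivWithinAt_power_line S X _).const_sub _).eventually_pos_right
          (by simpa using hSP) (by
          have := hcon none
          simp only [Option.elim] at this
          simpa using this)
      have h2 : ∀ᶠ s in 𝓝[>] (0 : ℝ),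
          0 < N.rate (S + s • X) 0 / I₀ 0 - N.rate S 0 / I₀ 0 := by
        refine ((hd 0).sub_const _).eventually_pos_right (by simp) ?_
        have := hcon (some 0)
        simp only [Option.elim, if_true] at this
        simpa using this
      have h3 : ∀ᶠ s in 𝓝[>] (0 : ℝ), ∀ l, l ≠ 0 →
          0 < N.rate (S + s • X) l / I₀ l - N.rate (S + s • X) 0 / I₀ 0 := by
        rw [Filter.eventually_all]
        intro l
        by_cases hl : l = 0
        · exact .of_forall fun s h => absurd hl h
        refine (((hd l).sub (hd 0)).eventually_pos_right ?_ ?_).mono fun s hs _ => hs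
        · simpa using hr l hl
        · have := hcon (some l)
          simp only [Option.elim, if_neg hl] at this
          simpa using this
      obtain ⟨s, hs1, hs2, hs3, hs4⟩ :=
        (h1.and (h2.and (h3.and (eventually_add_smul_posSemidef hS hT)))).exists
      have h4 : N.rate (S + s • X) 0 / I₀ 0 ≤ N.rate S 0 / I₀ 0 :=
        hmax ⟨fun l hl => by linarith [hs3 l hl], hs4, by linarith⟩
      linarith)
  set W : ℝ := ∑ l ∈ Finset.univ.erase 0, w (some l) with hW
  -- weights of the rates in the combination of the objective and the rate constraints
  set y : Fin L → ℝ := fun l => (if l = 0 then w (some 0) - W else w (some l)) / I₀ l with hy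
  have hyl : ∀ l, l ≠ 0 → y l = w (some l) / I₀ l := fun l hl => by simp only [hy, if_neg hl]
  have hy0 : y 0 = (w (some 0) - W) / I₀ 0 := by simp only [hy, if_true]
  set σ₁ : ℝ := ∑ l ∈ Finset.univ.erase 0,
    w (some l) * (N.rate S l / I₀ l - N.rate S 0 / I₀ 0) with hσ₁
  have hs1 : ∀ l ∈ Finset.univ.erase 0,
      0 ≤ w (some l) * (N.rate S l / I₀ l - N.rate S 0 / I₀ 0) := fun l hl =>
    mul_nonneg (hw _) (sub_nonneg.2 (hr l (Finset.ne_of_mem_erase hl)))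
  have hσ₁0 : 0 ≤ σ₁ := Finset.sum_nonneg hs1
  have hσ₂0 : 0 ≤ w none * (P - N.power S) := mul_nonneg (hw _) (sub_nonneg.2 hSP)
  have hineq : ∀ X : N.Cov, (∀ l, (S l + X l).PosSemidef) →
      ∑ l, y l * N.rateDeriv S X l - w none * N.power X + (σ₁ + w none * (P - N.power S)) ≤ 0 := by
    intro X hX
    have h1 := hle (S + X) hX
    have h2 : S + X + (-1 : ℝ) • S = X := by module
    rw [Fintype.sum_option] at h1
    simp only [Option.elim, h2] at h1
    rw [← Finset.add_sum_erase _ _ (Finset.mem_univ 0), if_pos rfl] at h1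
    rw [← Finset.add_sum_erase _ _ (Finset.mem_univ 0), hy0]
    have h3 : ∑ l ∈ Finset.univ.erase 0, w (some l) * (if l = 0 then N.rateDeriv S X 0 / I₀ 0 else
        N.rateDeriv S X l / I₀ l - N.rateDeriv S X 0 / I₀ 0 +
          (N.rate S l / I₀ l - N.rate S 0 / I₀ 0)) =
        ∑ l ∈ Finset.univ.erase 0, y l * N.rateDeriv S X l -
          W * (N.rateDeriv S X 0 / I₀ 0) + σ₁ := by
      rw [hσ₁, hW, Finset.sum_mul, ← Finset.sum_sub_distrib, ← Finset.sum_add_distrib]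
      refine Finset.sum_congr rfl fun l hl => ?_
      rw [if_neg (Finset.ne_of_mem_erase hl), hyl l (Finset.ne_of_mem_erase hl)]
      ring
    rw [h3] at h1
    have h4 : (w (some 0) - W) / I₀ 0 * N.rateDeriv S X 0 =
      w (some 0) * (N.rateDeriv S X 0 / I₀ 0) - W * (N.rateDeriv S X 0 / I₀ 0) := by ring
    rw [h4]
    linarith
  have hynn : ∀ l, 0 ≤ y l := by
    have h1 : ∀ l, l ≠ 0 → 0 ≤ y l := fun l hl => by
      rw [hyl l hl]; exact div_nonneg (hw _) (hI l).le
    intro l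
    by_cases hl : l = 0
    · rw [hl]
      exact nonneg_of_le_switch_off hS (hr0 0) h1 (hw none) (add_nonneg hσ₁0 hσ₂0) hineq
    · exact h1 l hl
  obtain ⟨hμ, hypos, hσ0, hpr⟩ := isPriced_of_le hS hr0 hynn (hw none) (fun h0 h1 => hw0 (by
      have h2 : ∀ l, l ≠ 0 → w (some l) = 0 := fun l hl => by
        have := congrFun h1 l
        rw [hyl l hl, Pi.zero_apply, div_eq_zero_iff] at this
        exact this.resolve_right (hI l).ne'
      have h3 : W = 0 := Finset.sum_eq_zero fun l hl => h2 l (Finset.ne_of_mem_erase hl)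
      have h4 := congrFun h1 0
      rw [hy0, h3, sub_zero, Pi.zero_apply, div_eq_zero_iff] at h4
      funext j
      rcases j with _ | l
      · exact h0
      · by_cases hl : l = 0
        · rw [hl]; exact h4.resolve_right (hI 0).ne'
        · exact h2 l hl)) (add_nonneg hσ₁0 hσ₂0) hineq
  have hσ₂ : w none * (P - N.power S) = 0 := by linarith
  have hσ₁' : σ₁ = 0 := by linarith
  refine ⟨⟨N.rate S 0 / I₀ 0, hα, fun l => ?_⟩, ?_, _,
    fun l => (div_pos (hypos l) hμ).le, hpr⟩
  · have h1 : N.rate S l / I₀ l = N.rate S 0 / I₀ 0 := by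
      by_cases hl : l = 0
      · rw [hl]
      · have h2 := (Finset.sum_eq_zero_iff_of_nonneg hs1).1 hσ₁' l
          (Finset.mem_erase.2 ⟨hl, Finset.mem_univ l⟩)
        refine sub_eq_zero.1 ((mul_eq_zero.1 h2).resolve_left fun h0 => (hypos l).ne' ?_)
        rw [hyl l hl, h0, zero_div]
    rw [← h1, div_mul_cancel₀ _ (hI l).ne']
  · exact (sub_eq_zero.1 ((mul_eq_zero.1 hσ₂).resolve_left hμ.ne')).symm

end BMAC

theorem mainTheorem3 {L : ℕ} [NeZero L] (N : BMAC L) (hH : ∀ l, N.H l l ≠ 0)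
    (I₀ : Fin L → ℝ) (hI : ∀ l, 0 < I₀ l) (P : ℝ) (hP : 0 < P) :
    -- necessity
    (∀ S : N.Cov, N.IsOptFOPa I₀ P S →
      (∃ S' : N.RevCov, N.IsCovTransform S S') ∧
      ∃ ν : Fin L → ℝ, ∀ S' : N.RevCov, N.IsCovTransform S S' → N.OptCondFOPa I₀ P S S' ν) ∧
    (∀ S : N.Cov, N.IsOptSPMP I₀ S →
      (∃ S' : N.RevCov, N.IsCovTransform S S') ∧
      ∃ ν : Fin L → ℝ, ∀ S' : N.RevCov, N.IsCovTransform S S' → N.OptCondSPMP I₀ S S' ν) ∧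
    -- the optimality conditions imply the KKT conditions and stationarity
    (∀ (S : N.Cov) (S' : N.RevCov) (ν : Fin L → ℝ), N.OptCondFOPa I₀ P S S' ν →
      N.KKTFOPa I₀ P S ∧ N.IsStationaryMax (N.objFOPa I₀) (N.feasFOPa I₀ P) S) ∧
    (∀ (S : N.Cov) (S' : N.RevCov) (ν : Fin L → ℝ), N.OptCondSPMP I₀ S S' ν →
      N.KKTSPMP I₀ S ∧ N.IsStationaryMax (fun T => -N.power T) (N.feasSPMP I₀) S) ∧
    -- sufficiency
    (∀ (S : N.Cov) (S' : N.RevCov) (ν : Fin L → ℝ), N.OptCondFOPa I₀ P S S' ν →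
      N.WeightedSumRateConcave ν → N.IsOptFOPa I₀ P S) ∧
    (∀ (S : N.Cov) (S' : N.RevCov) (ν : Fin L → ℝ), N.OptCondSPMP I₀ S S' ν →
      N.WeightedSumRateConcave ν → N.IsOptSPMP I₀ S) := by
  refine ⟨fun S h => ?_, fun S h => ?_, fun S S' ν h => h.kkt hI, fun S S' ν h => h.kkt,
    fun S S' ν h hc => h.isOpt hI hc, fun S S' ν h hc => h.isOpt hc⟩
  · obtain ⟨hr, hpow, ν, hν, hpr⟩ := h.isPriced hH hI hP
    have hS := h.1.2.1
    exact ⟨hpr.exists_isCovTransform hS (BMAC.dualCov_posSemidef hS hν), ν,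
      fun S' hS' => ⟨hpr.hasPoliteWaterFilling hν hS', hr, hpow⟩⟩
  · obtain ⟨hr, ν, hν, hpr⟩ := h.isPriced hI
    have hS := h.1.2
    exact ⟨hpr.exists_isCovTransform hS (BMAC.dualCov_posSemidef hS hν), ν,
      fun S' hS' => ⟨hpr.hasPoliteWaterFilling hν hS', hr⟩⟩
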